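/- For $u\in L^2(\mathbb S^1)$ write $\hat u(k)=\frac1{2\pi}\int_{-\pi}^{\pi}u(e^{i\theta})e^{-ik\theta}\,d\theta$, $\|u\|_{H^s}^2=\sum_{k\in\mathbb Z}(1+k^2)^s|\hat u(k)|^2$, $H^s_+(\mathbb S^1)=\{u\in L^2(\mathbb S^1):\ \|u\|_{H^s}<\infty,\ \hat u(k)=0\ \text{for all } k<0\}$, and, for $u$ with $\hat u(k)=0$ for all $k<0$, $\|u\|_W=\sum_{k\ge0}|\hat u(k)|\in[0,\infty]$. Let $\Pi\big(\sum_{k\in\mathbb Z}c_ke^{ik\theta}\big)=\sum_{k\ge0}c_ke^{ik\theta}$ be the Szegő projector and $(u\,|\,1)=\frac1{2\pi}\int_{-\pi}^{\pi}u(e^{i\theta})\,d\theta$. For every real $s>1$ there is a constant $C_s>0$, depending only on $s$, such that the following holds for every $\alpha\in\mathbb R$ and every $u_0\in H^s_+(\mathbb S^1)$. The $\alpha$-Szegő equation $$i\,\partial_tu=\Pi(|u|^2u)+\alpha\,(u\,|\,1),\qquad u(0)=u_0,$$ (understood in the sense of distributions on $\mathbb S^1$, i.e. coefficientwise for the Fourier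 coefficients, at every time $t\in\mathbb R$) has a unique global solution $u\in C(\mathbb R;H^{1/2}_+(\mathbb S^1))$, and this solution satisfies $$\|u(t)\|_W\le C_s\,\|u_0\|_{H^s}\qquad\text{for all } t\in\mathbb R .$$ -/

import Mathlib

open MeasureTheory Filter Topology

instance fact_two_pi_pos_circle : Fact (0 < 2 * Real.pi) := ⟨Real.two_pi_pos⟩

/-- The circle `𝕊¹`, parametrised by the angle `θ ∈ ℝ / 2πℤ`. -/
abbrev S1 : Type := AddCircle (2 * Real.pi)

/-- The normalised measure `dθ / 2π` on the circle. -/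
noncomputable abbrev circleMeasure : Measure S1 := AddCircle.haarAddCircle

/-- `L²(𝕊¹)`, complex valued, for the normalised measure. -/
noncomputable abbrev L2Circle : Type := Lp ℂ 2 circleMeasure

/-- `u ∈ H^s(𝕊¹)`: the series `∑ (1 + k²)^s |û(k)|²` over `k ∈ ℤ` converges. -/
def MemHs (s : ℝ) (u : L2Circle) : Prop :=
  Summable fun k : ℤ => (1 + (k : ℝ) ^ 2) ^ s * ‖fourierCoeff (u : S1 → ℂ) k‖ ^ 2

/-- `u ∈ H^s_+(𝕊¹)`: `u ∈ H^s(𝕊¹)` and `û(k) = 0` for all `k < 0`. -/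
def MemHsPlus (s : ℝ) (u : L2Circle) : Prop :=
  MemHs s u ∧ ∀ k : ℤ, k < 0 → fourierCoeff (u : S1 → ℂ) k = 0

/-- The Sobolev norm `‖u‖_{H^s} = (∑ (1 + k²)^s |û(k)|²)^{1/2}` (meaningful for `MemHs s u`). -/
noncomputable def hsNorm (s : ℝ) (u : L2Circle) : ℝ :=
  Real.sqrt (∑' k : ℤ, (1 + (k : ℝ) ^ 2) ^ s * ‖fourierCoeff (u : S1 → ℂ) k‖ ^ 2)

/-- `u` (with nonnegative frequencies) has finite Wiener norm. -/
def MemWiener (u : L2Circle) : Prop :=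
  Summable fun k : ℕ => ‖fourierCoeff (u : S1 → ℂ) (k : ℤ)‖

/-- The Wiener norm `‖u‖_W = ∑_{k ≥ 0} |û(k)|` of `u` with nonnegative frequencies
(meaningful for `MemWiener u`). -/
noncomputable def wienerNorm (u : L2Circle) : ℝ :=
  ∑' k : ℕ, ‖fourierCoeff (u : S1 → ℂ) (k : ℤ)‖

/-- The Szegő projector on distributions on the circle, these being represented by their
Fourier coefficients: `∑_{k ∈ ℤ} c k e^{ikθ} ↦ ∑_{k ≥ 0} c k e^{ikθ}`. -/
def szegoProj (c : ℤ → ℂ) : ℤ → ℂ := fun k => if 0 ≤ k then c k else 0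

/-- The cubic nonlinearity `|u|² u`. -/
noncomputable def cubic (u : L2Circle) : S1 → ℂ := fun x => ((‖u x‖ ^ 2 : ℝ) : ℂ) * u x

/-- The average `(u | 1) = (1 / 2π) ∫ u dθ`. -/
noncomputable def circleMean (u : L2Circle) : ℂ := ∫ x, u x ∂circleMeasure

/-- `u ∈ C(ℝ; H^{1/2}_+(𝕊¹))` is a global solution of the `α`-Szegő equation
`i ∂ₜ u = Π(|u|² u) + α (u | 1)` with `u(0) = u₀`. The equation holds in the sense of
distributions on the circle, that is, for every Fourier coefficient; the coefficients of
`|u|² u` are those of an integrable function because `H^{1/2}(𝕊¹) ⊆ L³(𝕊¹)`. -/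
structure IsAlphaSzegoSolution (α : ℝ) (u₀ : L2Circle) (u : ℝ → L2Circle) : Prop where
  mem : ∀ t, MemHsPlus (1 / 2) (u t)
  continuous : ∀ t₀, Tendsto (fun t => hsNorm (1 / 2) (u t - u t₀)) (𝓝 t₀) (𝓝 0)
  initial : u 0 = u₀
  equation : ∀ (t : ℝ) (k : ℤ), ∃ v : ℂ,
    HasDerivAt (fun τ => fourierCoeff (u τ : S1 → ℂ) k) v t ∧
    Complex.I * v = szegoProj (fourierCoeff (cubic (u t))) k
      + (α : ℂ) * fourierCoeff (fun _ : S1 => circleMean (u t)) k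

/-! The proof rests on a Lax pair for the shifted Hankel operator `hankelOp u`, with matrix `u (n +
m + 1)`. Its entries skip the zeroth coefficient, so the `α` term is invisible to it. Along the flow
the derivative of `hankelOp u` is `laxLeft u ∘L hankelOp u - hankelOp u ∘L laxRight u` with
skew-adjoint generators (`hankelOp_szegoField`). Evolving the canonical basis by the two generators
gives, for any two times `s` and `t`, orthonormal families with `u t (l + k + 1) = ⟪y l, hankelOp (u
s) (z k)⟫` (`IsTimeChangedSzego.exists_orthonormal`).

The Wiener bound is a trace norm bound in elementary form. For orthonormal `y`, `z` the sum of `|⟪y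
k, T z k⟫|` is at most the sum of the norms of the columns of `T` (`tsum_enorm_inner_le_columns`).
The main diagonal of the Hankel matrix carries the odd coefficients and the next diagonal the even
ones from 2 on; the zeroth is controlled by the conserved L² norm. Column `n` of the initial
operator is at most `(n + 1) ^ (-s) * ‖u₀‖_{H^s}`, which is summable exactly because `s > 1`.

Existence: on ℓ¹ the vector field is locally Lipschitz. Multiplying it by a scalar cutoff only
changes the speed of time, and the bound above survives any such change, so the cutoff never acts
and the solution is global. The Hilbert–Schmidt norm of the Hankel operator is the momentum `∑ j |u
j|²`; conservation of mass and momentum gives continuity in `H^{1/2}`.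

Uniqueness in `H^{1/2}` is of Yudovich type. That space just misses the bounded functions, with a
loss of `log N` on frequencies below `N`, while frequencies above `N` cost `N ^ (-1/4)`. Grönwall
then bounds the low modes of a difference by `N ^ (-1/4) * exp (A |t - t₀| (1 + log N))`, up to
constants, which vanishes as `N → ∞` on a short interval of fixed length. -/

/-! ### The sequence spaces ℓ¹ and ℓ², and linear maps given by values on basis vectors. -/

/-- Complex sequences with summable norm. -/
abbrev Ell1 : Type := lp (fun _ : ℕ => ℂ) 1

/-- Square summable complex sequences. -/
abbrev Ell2 : Type := lp (fun _ : ℕ => ℂ) 2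

/-- The canonical basis vector of `Ell1`. -/
noncomputable def ell1Basis (k : ℕ) : Ell1 := lp.single 1 k 1

/-- The canonical basis vector of `Ell2`. -/
noncomputable def ell2Basis (k : ℕ) : Ell2 := lp.single 2 k 1

theorem ell1Basis_apply (k n : ℕ) : ell1Basis k n = if n = k then 1 else 0 := by
  simp [ell1Basis, lp.single_apply, Pi.single_apply]

theorem ell2Basis_apply (k n : ℕ) : ell2Basis k n = if n = k then 1 else 0 := by
  simp [ell2Basis, lp.single_apply, Pi.single_apply]

theorem norm_ell1Basis (k : ℕ) : ‖ell1Basis k‖ = 1 := by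
  simp [ell1Basis, lp.norm_single]

theorem norm_ell2Basis (k : ℕ) : ‖ell2Basis k‖ = 1 := by
  simp [ell2Basis, lp.norm_single]

theorem inner_ell2Basis_left (k : ℕ) (x : Ell2) : inner ℂ (ell2Basis k) x = x k := by
  simp [ell2Basis, lp.inner_single_left]

theorem orthonormal_ell2Basis : Orthonormal ℂ ell2Basis := by
  rw [orthonormal_iff_ite]
  intro i j
  rw [inner_ell2Basis_left, ell2Basis_apply]

theorem Ell1.summable_norm (u : Ell1) : Summable fun k => ‖u k‖ := by
  simpa using (lp.memℓp u).summable (by simp)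

theorem Ell1.norm_eq_tsum (u : Ell1) : ‖u‖ = ∑' k, ‖u k‖ := by
  simpa using lp.norm_eq_tsum_rpow (by simp) u

theorem Ell2.hasSum_norm_sq (x : Ell2) : HasSum (fun k => ‖x k‖ ^ 2) (‖x‖ ^ 2) := by
  simpa using lp.hasSum_norm (p := 2) (by simp) x

theorem Ell1.hasSum_basis (u : Ell1) : HasSum (fun k => u k • ell1Basis k) u := by
  refine (lp.hasSum_single (p := 1) (by simp) u).congr_fun fun k => ?_
  rw [ell1Basis, ← lp.single_smul]
  simp

theorem Ell2.hasSum_basis (u : Ell2) : HasSum (fun k => u k • ell2Basis k) u := by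
  refine (lp.hasSum_single (p := 2) (by simp) u).congr_fun fun k => ?_
  rw [ell2Basis, ← lp.single_smul]
  simp

/-- Continuous linear maps on `Ell1` are determined by their values on basis vectors. -/
theorem ell1_ext {Y : Type*} [NormedAddCommGroup Y] [NormedSpace ℂ Y] {f g : Ell1 → Y}
    (hf : IsLinearMap ℂ f) (hg : IsLinearMap ℂ g) (hfc : Continuous f) (hgc : Continuous g)
    (h : ∀ k, f (ell1Basis k) = g (ell1Basis k)) : f = g := by
  funext u
  have h1 : HasSum (fun k => f (u k • ell1Basis k)) (f u) :=
    (Ell1.hasSum_basis u).map hf.mk' hfc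
  have h2 : HasSum (fun k => g (u k • ell1Basis k)) (g u) :=
    (Ell1.hasSum_basis u).map hg.mk' hgc
  refine h1.unique (h2.congr_fun fun k => ?_)
  rw [hf.map_smul, hg.map_smul, h k]

theorem ell2_ext {T T' : Ell2 →L[ℂ] Ell2}
    (h : ∀ k, T (ell2Basis k) = T' (ell2Basis k)) : T = T' := by
  ext1 u
  have h1 := (Ell2.hasSum_basis u).mapL T
  have h2 := (Ell2.hasSum_basis u).mapL T'
  refine h1.unique (h2.congr_fun fun k => ?_)
  rw [map_smul, map_smul, h k]

/-- The continuous linear map `u ↦ ∑ u k • A k` on `Ell1` for a family `A` in the unit ball. -/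
noncomputable def ell1Lift {Y : Type*} [NormedAddCommGroup Y] [NormedSpace ℂ Y] [CompleteSpace Y]
    (A : ℕ → Y) (hA : ∀ k, ‖A k‖ ≤ 1) : Ell1 →L[ℂ] Y :=
  have hle (u : Ell1) (k : ℕ) : ‖u k • A k‖ ≤ ‖u k‖ := by
    rw [norm_smul]
    exact mul_le_of_le_one_right (norm_nonneg _) (hA k)
  have hs (u : Ell1) : Summable fun k => u k • A k :=
    Summable.of_norm_bounded u.summable_norm (hle u)
  LinearMap.mkContinuous
    { toFun := fun u => ∑' k, u k • A k
      map_add' := fun u v => by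
        rw [← (hs u).tsum_add (hs v)]
        simp [add_smul]
      map_smul' := fun c u => by
        simp only [RingHom.id_apply]
        rw [← (hs u).tsum_const_smul]
        simp [mul_smul] } 1
    (fun u => by
      rw [one_mul, u.norm_eq_tsum]
      exact tsum_of_norm_bounded u.summable_norm.hasSum (hle u))

section lift
variable {Y : Type*} [NormedAddCommGroup Y] [NormedSpace ℂ Y] [CompleteSpace Y]
    {A : ℕ → Y} (hA : ∀ k, ‖A k‖ ≤ 1)

theorem norm_ell1Lift_le : ‖ell1Lift A hA‖ ≤ 1 := by
  unfold ell1Lift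
  exact LinearMap.mkContinuous_norm_le _ zero_le_one _

theorem norm_ell1Lift_apply_le (u : Ell1) : ‖ell1Lift A hA u‖ ≤ ‖u‖ := by
  simpa using (ell1Lift A hA).le_of_opNorm_le (norm_ell1Lift_le hA) u

theorem ell1Lift_apply (u : Ell1) : ell1Lift A hA u = ∑' k, u k • A k := rfl

@[simp] theorem ell1Lift_basis (k : ℕ) : ell1Lift A hA (ell1Basis k) = A k := by
  rw [ell1Lift_apply, tsum_eq_single k]
  · simp [ell1Basis_apply]
  · intro j hj
    simp [ell1Basis_apply, hj]

end lift

/-! ### Toeplitz and Hankel operators, the trilinear product and their commutator identity. -/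

/-- The contraction of `Ell2` that moves coordinates along an injective partial map. -/
noncomputable def partialShift (p : ℕ → Prop) [DecidablePred p] (f : ℕ → ℕ)
    (hf : ∀ n m, p n → p m → f n = f m → n = m) : Ell2 →L[ℂ] Ell2 :=
  have hle (x : Ell2) (F : Finset ℕ) :
      ∑ n ∈ F, ‖if p n then x (f n) else 0‖ ^ (2 : ENNReal).toReal
        ≤ ‖x‖ ^ (2 : ENNReal).toReal := by
    have h1 : ∑ n ∈ F, ‖if p n then x (f n) else 0‖ ^ (2 : ENNReal).toReal
        = ∑ n ∈ F.filter p, ‖x (f n)‖ ^ (2 : ENNReal).toReal := by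
      rw [Finset.sum_filter]
      refine Finset.sum_congr rfl fun n _ => ?_
      split_ifs <;> simp
    have h2 : ∑ n ∈ F.filter p, ‖x (f n)‖ ^ (2 : ENNReal).toReal
        = ∑ m ∈ (F.filter p).image f, ‖x m‖ ^ (2 : ENNReal).toReal := by
      rw [Finset.sum_image]
      intro n hn m hm h
      simp only [Finset.coe_filter, Set.mem_ofPred_eq] at hn hm
      exact hf n m hn.2 hm.2 h
    rw [h1, h2]
    exact lp.sum_rpow_le_norm_rpow (by simp) x _
  LinearMap.mkContinuous
    { toFun := fun x => ⟨fun n => if p n then x (f n) else 0, memℓp_gen' (hle x)⟩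
      map_add' := fun x y => by
        ext n
        simp only [lp.coeFn_add, Pi.add_apply]
        split_ifs <;> simp
      map_smul' := fun c x => by
        ext n
        simp only [lp.coeFn_smul, Pi.smul_apply, RingHom.id_apply]
        split_ifs <;> simp } 1
    (fun x => by
      rw [one_mul]
      exact lp.norm_le_of_forall_sum_le (by simp) (norm_nonneg _) (hle x))

theorem partialShift_apply (p : ℕ → Prop) [DecidablePred p] (f : ℕ → ℕ)
    (hf : ∀ n m, p n → p m → f n = f m → n = m) (x : Ell2) (n : ℕ) :
    partialShift p f hf x n = if p n then x (f n) else 0 := rfl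

theorem norm_partialShift_le (p : ℕ → Prop) [DecidablePred p] (f : ℕ → ℕ)
    (hf : ∀ n m, p n → p m → f n = f m → n = m) : ‖partialShift p f hf‖ ≤ 1 := by
  unfold partialShift
  exact LinearMap.mkContinuous_norm_le _ zero_le_one _

/-- Multiplication by `z ^ a` on the Hardy space. -/
noncomputable def fwdShift (a : ℕ) : Ell2 →L[ℂ] Ell2 :=
  partialShift (fun n => a ≤ n) (fun n => n - a) (by intro n m; omega)

/-- The Toeplitz operator of symbol `z ^ (-a)`. -/
noncomputable def bwdShift (a : ℕ) : Ell2 →L[ℂ] Ell2 :=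
  partialShift (fun _ => True) (fun n => n + a) (by intro n m; omega)

/-- The Hankel matrix with ones where the row and column indices add up to `a - 1`. -/
noncomputable def antiDiag (a : ℕ) : Ell2 →L[ℂ] Ell2 :=
  partialShift (fun n => n + 1 ≤ a) (fun n => a - 1 - n) (by intro n m; omega)

/-- Multiplication by `u` on the Hardy space. -/
noncomputable def mulOp : Ell1 →L[ℂ] (Ell2 →L[ℂ] Ell2) :=
  ell1Lift fwdShift fun _ => norm_partialShift_le _ _ _

/-- The Toeplitz operator with symbol `∑ v k z ^ (-k)`. -/
noncomputable def coMulOp : Ell1 →L[ℂ] (Ell2 →L[ℂ] Ell2) :=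
  ell1Lift bwdShift fun _ => norm_partialShift_le _ _ _

/-- The operator with Hankel matrix `u (n + m + 1)`. -/
noncomputable def hankelOp : Ell1 →L[ℂ] (Ell2 →L[ℂ] Ell2) :=
  ell1Lift antiDiag fun _ => norm_partialShift_le _ _ _

/-- The trilinear map `(a, b, v) ↦ Π (a b v̌)` where `v̌ = ∑ v k z ^ (-k)`. -/
noncomputable def trilin : Ell1 →L[ℂ] Ell1 →L[ℂ] Ell1 →L[ℂ] Ell1 :=
  ell1Lift (fun a => ell1Lift (fun b => ell1Lift
    (fun c => if c ≤ a + b then ell1Basis (a + b - c) else 0)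
    (fun c => by split_ifs <;> simp [norm_ell1Basis])) (fun _ => norm_ell1Lift_le _))
    (fun _ => norm_ell1Lift_le _)

theorem trilin_basis (a b c : ℕ) :
    trilin (ell1Basis a) (ell1Basis b) (ell1Basis c)
      = if c ≤ a + b then ell1Basis (a + b - c) else 0 := by
  simp [trilin]

theorem norm_trilin_le (a b v : Ell1) : ‖trilin a b v‖ ≤ ‖a‖ * ‖b‖ * ‖v‖ := by
  have h1 : ‖trilin a‖ ≤ ‖a‖ := norm_ell1Lift_apply_le _ a
  calc ‖trilin a b v‖ ≤ ‖trilin a b‖ * ‖v‖ := (trilin a b).le_opNorm v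
    _ ≤ (‖trilin a‖ * ‖b‖) * ‖v‖ := by gcongr; exact (trilin a).le_opNorm b
    _ ≤ _ := by gcongr

theorem mulOp_basis (k : ℕ) : mulOp (ell1Basis k) = fwdShift k := ell1Lift_basis _ _
theorem coMulOp_basis (k : ℕ) : coMulOp (ell1Basis k) = bwdShift k := ell1Lift_basis _ _
theorem hankelOp_basis (k : ℕ) : hankelOp (ell1Basis k) = antiDiag k := ell1Lift_basis _ _

theorem star_ell1Basis (k : ℕ) : star (ell1Basis k) = ell1Basis k := by
  ext n
  rw [lp.star_apply, ell1Basis_apply]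
  split_ifs <;> simp

theorem fwdShift_apply (a : ℕ) (x : Ell2) (n : ℕ) :
    fwdShift a x n = if a ≤ n then x (n - a) else 0 := rfl

theorem bwdShift_apply (a : ℕ) (x : Ell2) (n : ℕ) : bwdShift a x n = x (n + a) := by
  simp [bwdShift, partialShift_apply]

theorem antiDiag_apply (a : ℕ) (x : Ell2) (n : ℕ) :
    antiDiag a x n = if n + 1 ≤ a then x (a - 1 - n) else 0 := rfl

theorem eq_adjoint_of_basis {T T' : Ell2 →L[ℂ] Ell2}
    (h : ∀ n m, T' (ell2Basis m) n = star (T (ell2Basis n) m)) :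
    T' = ContinuousLinearMap.adjoint T := by
  refine ell2_ext fun m => ?_
  ext n
  rw [h, ← inner_ell2Basis_left n, ContinuousLinearMap.adjoint_inner_right,
    ← inner_conj_symm, inner_ell2Basis_left]
  rfl

theorem bwdShift_eq_adjoint (a : ℕ) :
    bwdShift a = ContinuousLinearMap.adjoint (fwdShift a) := by
  refine eq_adjoint_of_basis fun n m => ?_
  simp only [bwdShift_apply, fwdShift_apply, ell2Basis_apply]
  split_ifs <;> first | omega | simp

theorem antiDiag_eq_adjoint (a : ℕ) :
    antiDiag a = ContinuousLinearMap.adjoint (antiDiag a) := by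
  refine eq_adjoint_of_basis fun n m => ?_
  simp only [antiDiag_apply, ell2Basis_apply]
  split_ifs <;> first | omega | simp

theorem coMulOp_star (u : Ell1) :
    coMulOp (star u) = ContinuousLinearMap.adjoint (mulOp u) := by
  have : (fun v => coMulOp v) = fun v => ContinuousLinearMap.adjoint (mulOp (star v)) := by
    refine ell1_ext ⟨fun _ _ => map_add _ _ _, fun _ _ => map_smul _ _ _⟩
      ⟨fun x y => by simp, fun c x => by
        rw [star_smul, map_smul, LinearIsometryEquiv.map_smulₛₗ]; simp⟩ (by fun_prop) ?_ fun k => ?_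
    · exact (LinearIsometryEquiv.continuous _).comp (mulOp.continuous.comp continuous_star)
    · rw [star_ell1Basis, coMulOp_basis, mulOp_basis, bwdShift_eq_adjoint]
  simpa using congrFun this (star u)

/-- A Hankel matrix is symmetric, so its adjoint is its entrywise conjugate. -/
theorem hankelOp_star (u : Ell1) :
    hankelOp (star u) = ContinuousLinearMap.adjoint (hankelOp u) := by
  have : (fun v => hankelOp v) = fun v => ContinuousLinearMap.adjoint (hankelOp (star v)) := by
    refine ell1_ext ⟨fun _ _ => map_add _ _ _, fun _ _ => map_smul _ _ _⟩
      ⟨fun x y => by simp, fun c x => by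
        rw [star_smul, map_smul, LinearIsometryEquiv.map_smulₛₗ]; simp⟩ (by fun_prop) ?_ fun k => ?_
    · exact (LinearIsometryEquiv.continuous _).comp (hankelOp.continuous.comp continuous_star)
    · rw [star_ell1Basis, hankelOp_basis]
      exact antiDiag_eq_adjoint k
  simpa using congrFun this (star u)

/-- The commutator identity behind the Lax pair of the Szegő hierarchy. -/
theorem hankelOp_trilin (a b v : Ell1) :
    hankelOp (trilin a b v) = coMulOp v ∘L mulOp a ∘L hankelOp b
      + hankelOp a ∘L coMulOp b ∘L mulOp v - hankelOp a ∘L hankelOp v ∘L hankelOp b := by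
  have lin {f : Ell1 → Ell2 →L[ℂ] Ell2} (h1 : ∀ x y, f (x + y) = f x + f y)
      (h2 : ∀ (c : ℂ) x, f (c • x) = c • f x) : IsLinearMap ℂ f := ⟨h1, h2⟩
  revert v
  refine congrFun (ell1_ext (lin ?_ ?_) (lin ?_ ?_) (by fun_prop) (by fun_prop) fun c => ?_)
  · intro x y; simp
  · intro r x; simp
  · intro x y; simp only [map_add, ContinuousLinearMap.add_comp, ContinuousLinearMap.comp_add]; abel
  · intro r x
    simp only [map_smul, ContinuousLinearMap.smul_comp, ContinuousLinearMap.comp_smul, smul_add,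
      smul_sub]
  revert b
  refine congrFun (ell1_ext (lin ?_ ?_) (lin ?_ ?_) (by fun_prop) (by fun_prop) fun b => ?_)
  · intro x y; simp
  · intro r x; simp
  · intro x y; simp only [map_add, ContinuousLinearMap.add_comp, ContinuousLinearMap.comp_add]; abel
  · intro r x
    simp only [map_smul, ContinuousLinearMap.smul_comp, ContinuousLinearMap.comp_smul, smul_add,
      smul_sub]
  revert a
  refine congrFun (ell1_ext (lin ?_ ?_) (lin ?_ ?_) (by fun_prop) (by fun_prop) fun a => ?_)
  · intro x y; simp
  · intro r x; simp
  · intro x y; simp only [map_add, ContinuousLinearMap.add_comp, ContinuousLinearMap.comp_add]; abel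
  · intro r x
    simp only [map_smul, ContinuousLinearMap.smul_comp, ContinuousLinearMap.comp_smul, smul_add,
      smul_sub]
  have h0 : hankelOp (trilin (ell1Basis a) (ell1Basis b) (ell1Basis c)) = antiDiag (a + b - c) := by
    rw [trilin_basis]
    split_ifs with h
    · exact hankelOp_basis _
    -- Here `c > a + b`, and the truncated subtraction gives `antiDiag 0`, which vanishes.
    · ext x n
      rw [antiDiag_apply, if_neg (by omega)]
      simp
  rw [h0]
  ext x n
  simp only [hankelOp_basis, mulOp_basis, coMulOp_basis, sub_apply, add_apply,
    ContinuousLinearMap.comp_apply, lp.coeFn_sub, lp.coeFn_add, Pi.sub_apply, Pi.add_apply,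
    antiDiag_apply, fwdShift_apply, bwdShift_apply]
  have hx {i j : ℕ} (h : i = j) : x i = x j := by rw [h]
  -- The identity is inclusion–exclusion. All nonzero terms are the same coordinate of `x`, and all
  -- require `n + 1 + c ≤ a + b`. Beyond that the first needs `a ≤ n + c`, the second `n < a`, the
  -- third both, and at least one of the two always holds.
  split_ifs
  any_goals omega
  any_goals simp only [zero_add, add_zero, sub_zero, sub_self]
  · rw [hx (show b - 1 - (n + c - a) = a + b - c - 1 - n by omega),
      hx (show a - 1 - n + b - c = a + b - c - 1 - n by omega),
      hx (show b - 1 - (c - 1 - (a - 1 - n)) = a + b - c - 1 - n by omega)]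
    ring
  all_goals exact hx (by omega)

/-! ### Cut-off differential equations and linear skew-adjoint flows on compact intervals. -/

/-- The cutoff that equals `1` up to `R - 1` and `0` from `R` on. -/
noncomputable def cutoff (R r : ℝ) : ℝ := max 0 (min 1 (R - r))

theorem cutoff_nonneg (R r : ℝ) : 0 ≤ cutoff R r := le_max_left _ _

theorem cutoff_le_one (R r : ℝ) : cutoff R r ≤ 1 := by
  unfold cutoff; exact max_le zero_le_one (min_le_left _ _)

theorem cutoff_eq_one {R r : ℝ} (h : r + 1 ≤ R) : cutoff R r = 1 := by
  unfold cutoff; rw [min_eq_left (by linarith), max_eq_right zero_le_one]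

theorem cutoff_eq_zero {R r : ℝ} (h : R ≤ r) : cutoff R r = 0 := by
  unfold cutoff; rw [max_eq_left]; exact (min_le_right _ _).trans (by linarith)

theorem abs_cutoff_sub_le (R r s : ℝ) : |cutoff R r - cutoff R s| ≤ |r - s| := by
  unfold cutoff
  have h1 := abs_max_sub_max_le_abs (min 1 (R - r)) (min 1 (R - s)) 0
  have h2 := abs_min_sub_min_le_max 1 (R - r) 1 (R - s)
  rw [sub_self, abs_zero, max_eq_right (abs_nonneg _), sub_sub_sub_cancel_left,
    abs_sub_comm s] at h2
  rw [max_comm 0, max_comm 0]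
  exact h1.trans h2

theorem continuous_cutoff (R : ℝ) : Continuous (cutoff R) := by
  unfold cutoff; fun_prop

section
variable {E : Type*} [NormedAddCommGroup E] [NormedSpace ℝ E]

theorem norm_cutoff_smul_le {f : E → E} {R B : ℝ} (hB0 : 0 ≤ B)
    (hB : ∀ x, ‖x‖ ≤ R → ‖f x‖ ≤ B) (x : E) : ‖cutoff R ‖x‖ • f x‖ ≤ B := by
  rcases le_total ‖x‖ R with h | h
  · rw [norm_smul, Real.norm_of_nonneg (cutoff_nonneg _ _)]
    exact (mul_le_of_le_one_left (norm_nonneg _) (cutoff_le_one _ _)).trans (hB x h)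
  · rw [cutoff_eq_zero h, zero_smul, norm_zero]
    exact hB0

/-- One of the two points may be taken inside the ball, since both terms vanish outside. Then `K`
comes from varying `f`, and `B` from the 1-Lipschitz cutoff times the bound of `f` at the inner
point. -/
theorem cutoff_smul_lipschitz {f : E → E} {R K B : ℝ} (hK0 : 0 ≤ K)
    (hK : ∀ x y, ‖x‖ ≤ R → ‖y‖ ≤ R → ‖f x - f y‖ ≤ K * ‖x - y‖)
    (hB0 : 0 ≤ B) (hB : ∀ x, ‖x‖ ≤ R → ‖f x‖ ≤ B) (x y : E) :
    ‖cutoff R ‖x‖ • f x - cutoff R ‖y‖ • f y‖ ≤ (K + B) * ‖x - y‖ := by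
  wlog hy : ‖y‖ ≤ R generalizing x y
  · by_cases hx : ‖x‖ ≤ R
    · rw [norm_sub_rev, norm_sub_rev x y]
      exact this y x hx
    · rw [cutoff_eq_zero (le_of_not_ge hx), cutoff_eq_zero (le_of_not_ge hy)]
      simp only [zero_smul, sub_self, norm_zero]
      positivity
  have hd : |cutoff R ‖x‖ - cutoff R ‖y‖| * ‖f y‖ ≤ ‖x - y‖ * B :=
    mul_le_mul ((abs_cutoff_sub_le _ _ _).trans (abs_norm_sub_norm_le x y)) (hB y hy)
      (norm_nonneg _) (norm_nonneg _)
  by_cases hx : ‖x‖ ≤ R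
  · have e : cutoff R ‖x‖ • f x - cutoff R ‖y‖ • f y
        = cutoff R ‖x‖ • (f x - f y) + (cutoff R ‖x‖ - cutoff R ‖y‖) • f y := by
      rw [smul_sub, sub_smul]; abel
    have h1 : cutoff R ‖x‖ * ‖f x - f y‖ ≤ K * ‖x - y‖ :=
      (mul_le_of_le_one_left (norm_nonneg _) (cutoff_le_one _ _)).trans (hK x y hx hy)
    calc _ ≤ cutoff R ‖x‖ * ‖f x - f y‖ + |cutoff R ‖x‖ - cutoff R ‖y‖| * ‖f y‖ := by
          rw [e]
          refine (norm_add_le _ _).trans ?_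
          rw [norm_smul, norm_smul, Real.norm_of_nonneg (cutoff_nonneg _ _), Real.norm_eq_abs]
      _ ≤ _ := by linarith
  · rw [cutoff_eq_zero (le_of_not_ge hx), zero_sub] at hd
    rw [cutoff_eq_zero (le_of_not_ge hx), zero_smul, zero_sub, norm_neg, norm_smul,
      Real.norm_eq_abs]
    rw [abs_neg] at hd
    have := mul_nonneg hK0 (norm_nonneg (x - y))
    linarith

/-- Solvability on a whole interval of an equation whose vector field has been cut off outside
a ball. -/
theorem exists_cutoff_solution [CompleteSpace E] (f : ℝ → E → E) {a b t₀ : ℝ}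
    (ht₀ : t₀ ∈ Set.Icc a b) (x₀ : E) {R K B : ℝ} (hK0 : 0 ≤ K) (hB0 : 0 ≤ B)
    (hK : ∀ t ∈ Set.Icc a b, ∀ x y, ‖x‖ ≤ R → ‖y‖ ≤ R → ‖f t x - f t y‖ ≤ K * ‖x - y‖)
    (hB : ∀ t ∈ Set.Icc a b, ∀ x, ‖x‖ ≤ R → ‖f t x‖ ≤ B)
    (hc : ∀ x, ContinuousOn (fun t => f t x) (Set.Icc a b)) :
    ∃ x : ℝ → E, x t₀ = x₀ ∧ ∀ t ∈ Set.Icc a b,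
      HasDerivWithinAt x (cutoff R ‖x t‖ • f t (x t)) (Set.Icc a b) t := by
  have hab : a ≤ b := ht₀.1.trans ht₀.2
  -- The cut-off field is bounded by `B` on the whole space, so a solution cannot leave the ball of
  -- radius `B * (b - a)` and no smallness of the interval is needed. The radius `0` says that only
  -- one initial point is considered.
  have hP : IsPicardLindelof (fun t x => cutoff R ‖x‖ • f t x) (⟨t₀, ht₀⟩ : Set.Icc a b) x₀
      (Real.toNNReal (B * (b - a))) 0 (Real.toNNReal B) (Real.toNNReal (K + B)) := by
    constructor
    · intro t ht
      refine (LipschitzWith.of_dist_le_mul fun x y => ?_).lipschitzOnWith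
      rw [dist_eq_norm, dist_eq_norm, Real.coe_toNNReal _ (by positivity)]
      exact cutoff_smul_lipschitz hK0 (hK t ht) hB0 (hB t ht) x y
    · intro x _
      exact continuousOn_const.smul (hc x)
    · intro t ht x _
      rw [Real.coe_toNNReal _ hB0]
      exact norm_cutoff_smul_le hB0 (hB t ht) x
    · rw [Real.coe_toNNReal _ hB0, Real.coe_toNNReal _ (mul_nonneg hB0 (by linarith)),
        NNReal.coe_zero, sub_zero]
      refine mul_le_mul_of_nonneg_left (max_le ?_ ?_) hB0
      · exact sub_le_sub_left ht₀.1 b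
      · exact sub_le_sub_right ht₀.2 a
  exact hP.exists_eq_forall_mem_Icc_hasDerivWithinAt₀

end

section
variable {E : Type*} [NormedAddCommGroup E] [InnerProductSpace ℂ E]

theorem eq_of_hasDerivWithinAt_zero {F : Type*} [NormedAddCommGroup F] [NormedSpace ℝ F]
    {g : ℝ → F} {a b : ℝ} (h : ∀ t ∈ Set.Icc a b, HasDerivWithinAt g 0 (Set.Icc a b) t)
    {s t : ℝ} (hs : s ∈ Set.Icc a b) (ht : t ∈ Set.Icc a b) : g s = g t := by
  have := (convex_Icc a b).norm_image_sub_le_of_norm_hasDerivWithin_le (C := 0) h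
    (fun x _ => by simp) ht hs
  rw [zero_mul, norm_le_zero_iff, sub_eq_zero] at this
  exact this

/-- A time dependent linear equation with bounded skew-adjoint generators can be solved
on any compact interval. -/
theorem exists_skew_solution [CompleteSpace E] (A : ℝ → E →L[ℂ] E) {a b t₀ : ℝ}
    (hA : ContinuousOn A (Set.Icc a b)) (ht₀ : t₀ ∈ Set.Icc a b)
    (hskew : ∀ t ∈ Set.Icc a b, ∀ x y, inner ℂ (A t x) y + inner ℂ x (A t y) = 0) (x₀ : E) :
    ∃ x : ℝ → E, x t₀ = x₀ ∧ ∀ t ∈ Set.Icc a b,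
      HasDerivWithinAt x (A t (x t)) (Set.Icc a b) t := by
  obtain ⟨M, hM⟩ := isCompact_Icc.exists_bound_of_continuousOn hA
  have hM0 : 0 ≤ M := (norm_nonneg _).trans (hM t₀ ht₀)
  -- A real multiple of a skew-adjoint generator is still skew-adjoint, so even the cut-off flow
  -- keeps the norm `‖x₀‖`. With radius `‖x₀‖ + 1` the cutoff is therefore identically `1` along the
  -- solution.
  obtain ⟨x, hx0, hx⟩ := exists_cutoff_solution (fun t x => A t x) ht₀ x₀
    (R := ‖x₀‖ + 1) (K := M) (B := M * (‖x₀‖ + 1)) hM0 (by positivity)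
    (fun t ht x y _ _ => by
      rw [← map_sub]
      exact (A t).le_of_opNorm_le (hM t ht) _)
    (fun t ht x h => ((A t).le_of_opNorm_le (hM t ht) x).trans (by gcongr))
    (fun x => hA.clm_apply continuousOn_const)
  have hn : ∀ t ∈ Set.Icc a b, ‖x t‖ = ‖x₀‖ := by
    intro t ht
    have key : inner ℂ (x t) (x t) = inner ℂ (x t₀) (x t₀) := by
      refine eq_of_hasDerivWithinAt_zero (g := fun t => inner ℂ (x t) (x t)) (fun s hs => ?_) ht ht₀
      refine ((hx s hs).inner ℂ (hx s hs)).congr_deriv ?_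
      have h := hskew s hs (x s) (x s)
      rw [inner_smul_right_eq_smul, inner_smul_left_eq_smul, ← smul_add,
        add_comm (inner ℂ _ _), h, smul_zero]
    rw [hx0, inner_self_eq_norm_sq_to_K, inner_self_eq_norm_sq_to_K] at key
    have : ‖x t‖ ^ 2 = ‖x₀‖ ^ 2 := by exact_mod_cast key
    exact (pow_left_inj₀ (norm_nonneg _) (norm_nonneg _) two_ne_zero).1 this
  refine ⟨x, hx0, fun t ht => ?_⟩
  have := hx t ht
  rwa [hn t ht, cutoff_eq_one le_rfl, one_smul] at this

end

/-! ### The Lax pair. -/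

/-- The vector field of the `α`-Szegő equation on `Ell1`. -/
noncomputable def szegoField (α : ℝ) (u : Ell1) : Ell1 :=
  (-Complex.I) • (trilin u u (star u) + ((α : ℂ) * u 0) • ell1Basis 0)

/-- The generator acting on the left factor in the Lax pair. -/
noncomputable def laxLeft (u : Ell1) : Ell2 →L[ℂ] Ell2 :=
  (Complex.I / 2) • (hankelOp u ∘L hankelOp (star u))
    - Complex.I • (coMulOp (star u) ∘L mulOp u)

/-- The generator acting on the right factor in the Lax pair. -/
noncomputable def laxRight (u : Ell1) : Ell2 →L[ℂ] Ell2 :=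
  Complex.I • (coMulOp u ∘L mulOp (star u))
    - (Complex.I / 2) • (hankelOp (star u) ∘L hankelOp u)

theorem continuous_laxLeft : Continuous laxLeft := by
  unfold laxLeft
  have := continuous_star (R := Ell1)
  fun_prop

theorem continuous_laxRight : Continuous laxRight := by
  unfold laxRight
  have := continuous_star (R := Ell1)
  fun_prop

theorem hankelOp_adjoint_inner (u : Ell1) (x y : Ell2) :
    inner ℂ (hankelOp u x) y = inner ℂ x (hankelOp (star u) y) := by
  rw [hankelOp_star, ContinuousLinearMap.adjoint_inner_right]

theorem mulOp_adjoint_inner (u : Ell1) (x y : Ell2) :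
    inner ℂ (mulOp u x) y = inner ℂ x (coMulOp (star u) y) := by
  rw [coMulOp_star, ContinuousLinearMap.adjoint_inner_right]

theorem coMulOp_adjoint_inner (u : Ell1) (x y : Ell2) :
    inner ℂ (coMulOp u x) y = inner ℂ x (mulOp (star u) y) := by
  conv_lhs => rw [← star_star u]
  rw [coMulOp_star, ContinuousLinearMap.adjoint_inner_left]

/-- The generator is `Complex.I` times a real combination of products of the form `T T*` and `T* T`.
-/
theorem laxLeft_skew (u : Ell1) (x y : Ell2) :
    inner ℂ (laxLeft u x) y + inner ℂ x (laxLeft u y) = 0 := by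
  simp only [laxLeft, sub_apply, smul_apply, ContinuousLinearMap.comp_apply, inner_sub_left,
    inner_sub_right, inner_smul_left, inner_smul_right, hankelOp_adjoint_inner,
    coMulOp_adjoint_inner, mulOp_adjoint_inner, star_star, map_div₀, Complex.conj_I,
    Complex.conj_ofNat]
  ring

theorem laxRight_skew (u : Ell1) (x y : Ell2) :
    inner ℂ (laxRight u x) y + inner ℂ x (laxRight u y) = 0 := by
  simp only [laxRight, sub_apply, smul_apply, ContinuousLinearMap.comp_apply, inner_sub_left,
    inner_sub_right, inner_smul_left, inner_smul_right, hankelOp_adjoint_inner,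
    coMulOp_adjoint_inner, mulOp_adjoint_inner, star_star, map_div₀, Complex.conj_I,
    Complex.conj_ofNat]
  ring

/-- This is why `α` does not affect the Lax equation: the mean term only moves the zeroth
coefficient. -/
theorem hankelOp_basis_zero : hankelOp (ell1Basis 0) = 0 := by
  rw [hankelOp_basis]
  ext x n
  rw [antiDiag_apply, if_neg (by omega)]
  simp

/-- The Lax equation for the shifted Hankel operator. -/
theorem hankelOp_szegoField (α : ℝ) (u : Ell1) :
    hankelOp (szegoField α u) = laxLeft u ∘L hankelOp u - hankelOp u ∘L laxRight u := by
  unfold szegoField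
  -- In the commutator identity with `a = b = u` and `v = star u`, the first product belongs to the
  -- left generator and the second to the right one. The triple Hankel product is shared equally,
  -- whence the factors `Complex.I / 2`.
  rw [map_smul, map_add, map_smul, hankelOp_basis_zero, hankelOp_trilin]
  ext x n
  simp only [laxLeft, laxRight, sub_apply, add_apply, smul_apply, ContinuousLinearMap.comp_apply,
    map_sub, map_smul, lp.coeFn_sub, lp.coeFn_add, lp.coeFn_smul, Pi.sub_apply, Pi.add_apply,
    Pi.smul_apply, smul_eq_mul, smul_zero, add_zero]
  ring

theorem real_smul_ell1 (r : ℝ) (x : Ell1) : r • x = (r : ℂ) • x := rfl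

theorem real_smul_ell2 (r : ℝ) (x : Ell2) : r • x = (r : ℂ) • x := rfl

/-- The inclusion of `Ell1` into `Ell2`. -/
noncomputable def ell1ToEll2 : Ell1 →L[ℂ] Ell2 :=
  ell1Lift ell2Basis fun k => (norm_ell2Basis k).le

theorem ell1ToEll2_basis (k : ℕ) : ell1ToEll2 (ell1Basis k) = ell2Basis k := ell1Lift_basis _ _

theorem continuous_apply_ell1 (n : ℕ) : Continuous fun u : Ell1 => u n :=
  (lp.evalCLM ℂ (fun _ : ℕ => ℂ) 1 n).continuous

theorem continuous_apply_ell2 (n : ℕ) : Continuous fun u : Ell2 => u n :=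
  (lp.evalCLM ℂ (fun _ : ℕ => ℂ) 2 n).continuous

theorem ell1ToEll2_apply (u : Ell1) (n : ℕ) : ell1ToEll2 u n = u n := by
  revert u
  refine congrFun (ell1_ext ⟨by simp, by simp⟩ ⟨by simp, by simp⟩ ?_ ?_ fun k => ?_)
  · exact (continuous_apply_ell2 n).comp ell1ToEll2.continuous
  · exact continuous_apply_ell1 n
  · rw [ell1ToEll2_basis, ell2Basis_apply, ell1Basis_apply]

theorem hankelOp_basis_apply (u : Ell1) (k l : ℕ) :
    hankelOp u (ell2Basis k) l = u (l + k + 1) := by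
  revert u
  refine congrFun (ell1_ext ⟨by simp, by simp⟩ ⟨by simp, by simp⟩ ?_ ?_ fun j => ?_)
  · exact (continuous_apply_ell2 l).comp (by fun_prop)
  · exact continuous_apply_ell1 _
  · rw [hankelOp_basis, antiDiag_apply, ell2Basis_apply, ell1Basis_apply]
    split_ifs <;> first | omega | rfl

theorem ell1ToEll2_trilin (a b v : Ell1) :
    ell1ToEll2 (trilin a b v) = coMulOp v (mulOp a (ell1ToEll2 b)) := by
  revert v
  refine congrFun (ell1_ext ⟨by simp, by simp⟩ ⟨by simp, by simp⟩ (by fun_prop) (by fun_prop)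
    fun c => ?_)
  revert b
  refine congrFun (ell1_ext ⟨by simp, by simp⟩ ⟨by simp, by simp⟩ (by fun_prop) (by fun_prop)
    fun b => ?_)
  revert a
  refine congrFun (ell1_ext ⟨by simp, by simp⟩ ⟨by simp, by simp⟩ (by fun_prop) (by fun_prop)
    fun a => ?_)
  ext n
  rw [ell1ToEll2_apply, trilin_basis, coMulOp_basis, mulOp_basis, ell1ToEll2_basis,
    bwdShift_apply, fwdShift_apply, ell2Basis_apply, apply_ite (fun w : Ell1 => w n),
    ell1Basis_apply]
  split_ifs <;> first | omega | rfl

/-! ### Conserved structure along the flow, at arbitrary real speed. -/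

/-- `u` solves the `α`-Szegő equation on `[a, b]` up to the time change with speed `c`. -/
structure IsTimeChangedSzego (α a b : ℝ) (c : ℝ → ℝ) (u : ℝ → Ell1) : Prop where
  cont : ContinuousOn c (Set.Icc a b)
  deriv : ∀ t ∈ Set.Icc a b,
    HasDerivWithinAt u (c t • szegoField α (u t)) (Set.Icc a b) t

namespace IsTimeChangedSzego
variable {α a b : ℝ} {c : ℝ → ℝ} {u : ℝ → Ell1}

theorem continuousOn (h : IsTimeChangedSzego α a b c u) : ContinuousOn u (Set.Icc a b) :=
  fun t ht => (h.deriv t ht).continuousWithinAt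

/-- The pairing of `u` with the field is `-Complex.I` times `‖mulOp u u‖² + α |u 0|²`, which is
real, so its real part is zero. -/
theorem norm_ell2_eq (h : IsTimeChangedSzego α a b c u) {s t : ℝ} (hs : s ∈ Set.Icc a b)
    (ht : t ∈ Set.Icc a b) : ‖ell1ToEll2 (u s)‖ = ‖ell1ToEll2 (u t)‖ := by
  have key : inner ℂ (ell1ToEll2 (u s)) (ell1ToEll2 (u s))
      = inner ℂ (ell1ToEll2 (u t)) (ell1ToEll2 (u t)) := by
    refine eq_of_hasDerivWithinAt_zero (g := fun t => inner ℂ (ell1ToEll2 (u t))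
      (ell1ToEll2 (u t))) (fun r hr => ?_) hs ht
    have hd : HasDerivWithinAt (fun t => ell1ToEll2 (u t))
        (ell1ToEll2 (c r • szegoField α (u r))) (Set.Icc a b) r :=
      (ell1ToEll2.restrictScalars ℝ).hasFDerivAt.comp_hasDerivWithinAt r (h.deriv r hr)
    refine (hd.inner ℂ hd).congr_deriv ?_
    rw [real_smul_ell1]
    simp only [szegoField, map_smul, map_add, ell1ToEll2_trilin, ell1ToEll2_basis,
      inner_smul_left, inner_smul_right, inner_add_left, inner_add_right, coMulOp_adjoint_inner,
      star_star, inner_ell2Basis_left, ← inner_conj_symm _ (ell2Basis 0), ell1ToEll2_apply,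
      ← mulOp_adjoint_inner, map_neg, map_mul, Complex.conj_I, Complex.conj_ofReal]
    ring
  rw [inner_self_eq_norm_sq_to_K, inner_self_eq_norm_sq_to_K] at key
  have : ‖ell1ToEll2 (u s)‖ ^ 2 = ‖ell1ToEll2 (u t)‖ ^ 2 := by exact_mod_cast key
  exact (pow_left_inj₀ (norm_nonneg _) (norm_nonneg _) two_ne_zero).1 this

theorem orthonormal_of_skew {A : ℝ → Ell2 →L[ℂ] Ell2} {x : ℕ → ℝ → Ell2} {s t : ℝ}
    (hskew : ∀ r ∈ Set.Icc a b, ∀ x y, inner ℂ (A r x) y + inner ℂ x (A r y) = 0)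
    (hx : ∀ k, ∀ r ∈ Set.Icc a b, HasDerivWithinAt (x k) (A r (x k r)) (Set.Icc a b) r)
    (hs : s ∈ Set.Icc a b) (ht : t ∈ Set.Icc a b) (h : Orthonormal ℂ fun k => x k s) :
    Orthonormal ℂ fun k => x k t := by
  rw [orthonormal_iff_ite] at h ⊢
  intro i j
  rw [← h i j]
  refine eq_of_hasDerivWithinAt_zero (g := fun t => inner ℂ (x i t) (x j t))
    (fun r hr => ?_) ht hs
  refine ((hx i r hr).inner ℂ (hx j r hr)).congr_deriv ?_
  rw [add_comm, hskew r hr]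

/-- Unitary equivalence of the Hankel operators of a solution at different times, on the level
of matrix entries. -/
theorem exists_orthonormal (h : IsTimeChangedSzego α a b c u) {s t : ℝ} (hs : s ∈ Set.Icc a b)
    (ht : t ∈ Set.Icc a b) : ∃ y z : ℕ → Ell2, Orthonormal ℂ y ∧ Orthonormal ℂ z ∧
      ∀ k l, u t (l + k + 1) = inner ℂ (y l) (hankelOp (u s) (z k)) := by
  have skew {T : Ell2 →L[ℂ] Ell2} (hT : ∀ x y, inner ℂ (T x) y + inner ℂ x (T y) = 0) (r : ℝ)
      (x y : Ell2) : inner ℂ ((r • T) x) y + inner ℂ x ((r • T) y) = 0 := by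
    rw [smul_apply, smul_apply, inner_smul_right_eq_smul, inner_smul_left_eq_smul, ← smul_add,
      hT, smul_zero]
  have hy1 := fun r (_ : r ∈ Set.Icc a b) => skew (laxLeft_skew (u r)) (c r)
  have hz1 := fun r (_ : r ∈ Set.Icc a b) => skew (laxRight_skew (u r)) (c r)
  -- Both flows start from the canonical basis at time `t`, where the pairing with the Hankel
  -- operator reads off coefficients of `u t`. They are then evaluated at time `s`.
  choose y hy0 hy using fun k : ℕ => exists_skew_solution (fun r => c r • laxLeft (u r))
    (h.cont.smul (continuous_laxLeft.comp_continuousOn h.continuousOn)) ht hy1 (ell2Basis k)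
  choose z hz0 hz using fun k : ℕ => exists_skew_solution (fun r => c r • laxRight (u r))
    (h.cont.smul (continuous_laxRight.comp_continuousOn h.continuousOn)) ht hz1 (ell2Basis k)
  refine ⟨fun k => y k s, fun k => z k s, ?_, ?_, fun k l => ?_⟩
  · refine orthonormal_of_skew hy1 hy ht hs ?_
    simpa only [hy0] using orthonormal_ell2Basis
  · refine orthonormal_of_skew hz1 hz ht hs ?_
    simpa only [hz0] using orthonormal_ell2Basis
  · have hend : u t (l + k + 1) = inner ℂ (y l t) (hankelOp (u t) (z k t)) := by
      rw [hy0, hz0, inner_ell2Basis_left, hankelOp_basis_apply]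
    rw [hend]
    refine eq_of_hasDerivWithinAt_zero
      (g := fun t => inner ℂ (y l t) (hankelOp (u t) (z k t))) (fun r hr => ?_) ht hs
    have hd : HasDerivWithinAt (fun t => hankelOp (u t) (z k t))
        (hankelOp (u r) ((c r • laxRight (u r)) (z k r))
          + hankelOp (c r • szegoField α (u r)) (z k r)) (Set.Icc a b) r := by
      have hB := (hankelOp.bilinearRestrictScalars ℝ).isBoundedBilinearMap.hasFDerivAt
        (u r, z k r)
      exact hB.comp_hasDerivWithinAt r ((h.deriv r hr).prodMk (hz k r hr))
    refine ((hy l r hr).inner ℂ hd).congr_deriv ?_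
    -- In the derivative of the pairing, `laxRight` cancels between `z` and the Lax equation, and
    -- `laxLeft` cancels by skewness.
    have h1 := laxLeft_skew (u r) (y l r) (hankelOp (u r) (z k r))
    rw [real_smul_ell1, map_smul, hankelOp_szegoField, smul_apply, smul_apply, smul_apply,
      real_smul_ell2, real_smul_ell2]
    simp only [sub_apply, ContinuousLinearMap.comp_apply, map_smul, inner_add_right,
      inner_sub_right, inner_smul_right, inner_smul_left, Complex.conj_ofReal]
    linear_combination (c r : ℂ) * h1

end IsTimeChangedSzego

/-! ### Trace and Hilbert–Schmidt bounds through Bessel's inequality, and the a priori estimates. -/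

section bessel
variable {E : Type*} [NormedAddCommGroup E] [InnerProductSpace ℂ E]

theorem Orthonormal.tsum_enorm_inner_sq_le {ι : Type*} {v : ι → E} (hv : Orthonormal ℂ v)
    (x : E) : ∑' i, ‖inner ℂ (v i) x‖ₑ ^ 2 ≤ ‖x‖ₑ ^ 2 := by
  rw [ENNReal.tsum_eq_iSup_sum]
  refine iSup_le fun s => ?_
  have h := ENNReal.ofReal_le_ofReal (hv.sum_inner_products_le x (s := s))
  rw [ENNReal.ofReal_sum_of_nonneg fun _ _ => by positivity] at h
  simpa only [ENNReal.ofReal_pow (norm_nonneg _), ofReal_norm] using h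

theorem Orthonormal.tsum_enorm_inner_mul_le {ι : Type*} {v w : ι → E} (hv : Orthonormal ℂ v)
    (hw : Orthonormal ℂ w) (x y : E) :
    ∑' i, ‖inner ℂ (v i) x‖ₑ * ‖inner ℂ (w i) y‖ₑ ≤ ‖x‖ₑ * ‖y‖ₑ := by
  rw [ENNReal.tsum_eq_iSup_sum]
  refine iSup_le fun s => ?_
  have h1 : ∑ i ∈ s, ‖inner ℂ (v i) x‖ * ‖inner ℂ (w i) y‖ ≤ ‖x‖ * ‖y‖ := by
    refine (Real.sum_mul_le_sqrt_mul_sqrt _ _ _).trans ?_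
    refine mul_le_mul (Real.sqrt_le_left (norm_nonneg _) |>.2 (hv.sum_inner_products_le x))
      (Real.sqrt_le_left (norm_nonneg _) |>.2 (hw.sum_inner_products_le y)) (Real.sqrt_nonneg _)
      (norm_nonneg _)
  have h := ENNReal.ofReal_le_ofReal h1
  rw [ENNReal.ofReal_sum_of_nonneg fun _ _ => by positivity] at h
  simpa only [ENNReal.ofReal_mul (norm_nonneg _), ofReal_norm] using h

end bessel

theorem Ell2.tsum_enorm_sq (x : Ell2) : ∑' n, ‖x n‖ₑ ^ 2 = ‖x‖ₑ ^ 2 := by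
  have h := x.hasSum_norm_sq
  rw [← ofReal_norm, ← ENNReal.ofReal_pow (norm_nonneg _), ← h.tsum_eq,
    ENNReal.ofReal_tsum_of_nonneg (fun _ => by positivity) h.summable]
  simp only [ENNReal.ofReal_pow (norm_nonneg _), ofReal_norm]

theorem Ell1.tsum_enorm (x : Ell1) : ∑' n, ‖x n‖ₑ = ‖x‖ₑ := by
  rw [← ofReal_norm, x.norm_eq_tsum,
    ENNReal.ofReal_tsum_of_nonneg (fun _ => by positivity) x.summable_norm]
  simp only [ofReal_norm]

/-- The diagonal sum of an operator in a pair of orthonormal families is controlled by the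
norms of its columns. -/
theorem tsum_enorm_inner_le_columns {T : Ell2 →L[ℂ] Ell2} {y z : ℕ → Ell2}
    (hy : Orthonormal ℂ y) (hz : Orthonormal ℂ z) :
    ∑' k, ‖inner ℂ (y k) (T (z k))‖ₑ ≤ ∑' n, ‖T (ell2Basis n)‖ₑ := by
  -- Expand `z k` in the canonical basis. After exchanging the sums, Cauchy–Schwarz and Bessel in
  -- `k` bound the `n`-th term by `‖e n‖ * ‖T (e n)‖`.
  have h1 (k : ℕ) : ‖inner ℂ (y k) (T (z k))‖ₑ
      ≤ ∑' n, ‖inner ℂ (z k) (ell2Basis n)‖ₑ * ‖inner ℂ (y k) (T (ell2Basis n))‖ₑ := by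
    have hs : HasSum (fun n => z k n * inner ℂ (y k) (T (ell2Basis n)))
        (inner ℂ (y k) (T (z k))) := by
      have := ((Ell2.hasSum_basis (z k)).mapL T).mapL (innerSL ℂ (y k))
      simpa only [map_smul, innerSL_apply_apply, smul_eq_mul] using this
    rw [← hs.tsum_eq]
    refine enorm_tsum_le_tsum_enorm.trans (ENNReal.tsum_le_tsum fun n => ?_)
    rw [enorm_mul, ← inner_ell2Basis_left n (z k), ← inner_conj_symm, RCLike.enorm_conj]
  refine (ENNReal.tsum_le_tsum h1).trans ?_
  rw [ENNReal.tsum_comm]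
  refine ENNReal.tsum_le_tsum fun n => ?_
  refine (hz.tsum_enorm_inner_mul_le hy _ _).trans ?_
  rw [← ofReal_norm (ell2Basis n), norm_ell2Basis, ENNReal.ofReal_one, one_mul]

/-- The Hilbert–Schmidt norm does not increase under compression to orthonormal families. -/
theorem tsum_enorm_inner_sq_le_rows {T : Ell2 →L[ℂ] Ell2} {y z : ℕ → Ell2}
    (hy : Orthonormal ℂ y) (hz : Orthonormal ℂ z) :
    ∑' k, ∑' l, ‖inner ℂ (y l) (T (z k))‖ₑ ^ 2
      ≤ ∑' n, ‖ContinuousLinearMap.adjoint T (ell2Basis n)‖ₑ ^ 2 := by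
  have h1 (k : ℕ) : ∑' l, ‖inner ℂ (y l) (T (z k))‖ₑ ^ 2
      ≤ ∑' n, ‖inner ℂ (z k) (ContinuousLinearMap.adjoint T (ell2Basis n))‖ₑ ^ 2 := by
    refine (hy.tsum_enorm_inner_sq_le _).trans ?_
    rw [← Ell2.tsum_enorm_sq]
    refine ENNReal.tsum_le_tsum fun n => ?_
    rw [ContinuousLinearMap.adjoint_inner_right, ← inner_ell2Basis_left n, ← inner_conj_symm,
      RCLike.enorm_conj]
  refine (ENNReal.tsum_le_tsum h1).trans ?_
  rw [ENNReal.tsum_comm]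
  exact ENNReal.tsum_le_tsum fun n => hz.tsum_enorm_inner_sq_le _

/-- The momentum `∑ j |u j|²`. -/
noncomputable def momentum (u : ℕ → ℂ) : ENNReal := ∑' j : ℕ, (j : ENNReal) * ‖u j‖ₑ ^ 2

/-- The antidiagonal `l + k = n` has `n + 1` entries, all equal to `u (n + 1)`; the index `j = 0`
has weight zero. -/
theorem tsum_enorm_hankel_sq (u : ℕ → ℂ) :
    ∑' k, ∑' l, ‖u (l + k + 1)‖ₑ ^ 2 = momentum u := by
  rw [← ENNReal.tsum_prod (f := fun k l => ‖u (l + k + 1)‖ₑ ^ 2),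
    ← Finset.HasAntidiagonal.sigmaAntidiagonalEquivProd.tsum_eq, ENNReal.tsum_sigma', momentum,
    tsum_eq_zero_add' (f := fun j : ℕ => (j : ENNReal) * ‖u j‖ₑ ^ 2) ENNReal.summable]
  rw [Nat.cast_zero, zero_mul, zero_add]
  refine tsum_congr fun n => ?_
  rw [tsum_fintype, Finset.univ_eq_attach]
  have : ∀ x ∈ (Finset.HasAntidiagonal.antidiagonal n).attach,
      ‖u ((Finset.HasAntidiagonal.sigmaAntidiagonalEquivProd ⟨n, x⟩).2
        + (Finset.HasAntidiagonal.sigmaAntidiagonalEquivProd ⟨n, x⟩).1 + 1)‖ₑ ^ 2 = ‖u (n + 1)‖ₑ ^ 2 := by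
    intro x _
    have hx := Finset.HasAntidiagonal.mem_antidiagonal.1 x.2
    change ‖u (x.1.2 + x.1.1 + 1)‖ₑ ^ 2 = _
    rw [add_comm x.1.2, hx]
  rw [Finset.sum_congr rfl this]
  simp

theorem norm_hankelOp_basis_sq (u : Ell1) (n : ℕ) :
    ‖hankelOp u (ell2Basis n)‖ₑ ^ 2 = ∑' m, ‖u (m + n + 1)‖ₑ ^ 2 := by
  rw [← Ell2.tsum_enorm_sq]
  simp only [hankelOp_basis_apply]

namespace IsTimeChangedSzego
variable {α a b : ℝ} {c : ℝ → ℝ} {u : ℝ → Ell1}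

/-- The momentum is the squared Hilbert–Schmidt norm of the Hankel operator. Bessel alone gives the
inequality, and exchanging the two times gives equality. The adjoint that appears is the Hankel
operator of the conjugate sequence, which has the same moduli. -/
theorem momentum_le (h : IsTimeChangedSzego α a b c u) {s t : ℝ} (hs : s ∈ Set.Icc a b)
    (ht : t ∈ Set.Icc a b) : momentum (u t) ≤ momentum (u s) := by
  obtain ⟨y, z, hy, hz, hyz⟩ := h.exists_orthonormal hs ht
  rw [← tsum_enorm_hankel_sq (u t)]
  simp only [hyz]
  refine (tsum_enorm_inner_sq_le_rows hy hz).trans (le_of_eq ?_)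
  rw [← hankelOp_star, ← tsum_enorm_hankel_sq]
  refine tsum_congr fun n => ?_
  rw [norm_hankelOp_basis_sq]
  refine tsum_congr fun m => ?_
  rw [lp.star_apply]
  exact congrArg (· ^ 2) (RCLike.enorm_conj _)

theorem momentum_eq (h : IsTimeChangedSzego α a b c u) {s t : ℝ} (hs : s ∈ Set.Icc a b)
    (ht : t ∈ Set.Icc a b) : momentum (u t) = momentum (u s) :=
  (h.momentum_le hs ht).antisymm (h.momentum_le ht hs)

/-- Odd coefficients are the diagonal entries `⟪y k, T (z k)⟫`. The even ones from 2 on are `⟪y (k +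
1), T (z k)⟫`, and the shifted family is again orthonormal; hence the factor 2. The speed `c` does
not enter. -/
theorem enorm_le (h : IsTimeChangedSzego α a b c u) {s t : ℝ} (hs : s ∈ Set.Icc a b)
    (ht : t ∈ Set.Icc a b) :
    ‖u t‖ₑ ≤ ‖ell1ToEll2 (u s)‖ₑ + 2 * ∑' n, ‖hankelOp (u s) (ell2Basis n)‖ₑ := by
  obtain ⟨y, z, hy, hz, hyz⟩ := h.exists_orthonormal hs ht
  rw [← Ell1.tsum_enorm, tsum_eq_zero_add' ENNReal.summable]
  refine add_le_add ?_ ?_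
  · rw [← ofReal_norm (ell1ToEll2 (u s)), h.norm_ell2_eq hs ht, ofReal_norm, ← ell1ToEll2_apply]
    rw [enorm_le_iff_norm_le]
    exact lp.norm_apply_le_norm (by simp) _ _
  · have h1 : ∑' k, ‖u t (2 * k + 1)‖ₑ ≤ ∑' n, ‖hankelOp (u s) (ell2Basis n)‖ₑ := by
      refine le_trans (le_of_eq (tsum_congr fun k => ?_)) (tsum_enorm_inner_le_columns hy hz)
      rw [← hyz, two_mul]
    have h2 : ∑' k, ‖u t (2 * k + 1 + 1)‖ₑ ≤ ∑' n, ‖hankelOp (u s) (ell2Basis n)‖ₑ := by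
      refine le_trans (le_of_eq (tsum_congr fun k => ?_)) (tsum_enorm_inner_le_columns
        (hy.comp (fun k => k + 1) fun _ _ => by simp) hz)
      rw [Function.comp_apply, ← hyz, show 2 * k + 1 + 1 = k + 1 + k + 1 by omega]
    rw [← tsum_even_add_odd ENNReal.summable ENNReal.summable, two_mul]
    exact add_le_add h1 h2

end IsTimeChangedSzego

/-! ### Global existence in ℓ¹. -/

theorem norm_trilin_cubic_sub_le {R : ℝ} {u v : Ell1} (hu : ‖u‖ ≤ R) (hv : ‖v‖ ≤ R) :
    ‖trilin u u (star u) - trilin v v (star v)‖ ≤ 3 * R ^ 2 * ‖u - v‖ := by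
  have hR : 0 ≤ R := (norm_nonneg u).trans hu
  have e : trilin u u (star u) - trilin v v (star v)
      = trilin (u - v) u (star u) + trilin v (u - v) (star u) + trilin v v (star (u - v)) := by
    simp only [star_sub, map_sub, sub_apply]
    abel
  rw [e]
  have h1 := norm_trilin_le (u - v) u (star u)
  have h2 := norm_trilin_le v (u - v) (star u)
  have h3 := norm_trilin_le v v (star (u - v))
  rw [norm_star] at h1 h2 h3
  have h := norm_nonneg (u - v)
  calc _ ≤ ‖u - v‖ * ‖u‖ * ‖u‖ + ‖v‖ * ‖u - v‖ * ‖u‖ + ‖v‖ * ‖v‖ * ‖u - v‖ := by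
        refine (norm_add₃_le).trans ?_
        gcongr
    _ ≤ ‖u - v‖ * R * R + R * ‖u - v‖ * R + R * R * ‖u - v‖ := by gcongr
    _ = _ := by ring

theorem szegoField_sub_norm_le {α R : ℝ} {u v : Ell1} (hu : ‖u‖ ≤ R) (hv : ‖v‖ ≤ R) :
    ‖szegoField α u - szegoField α v‖ ≤ (3 * R ^ 2 + |α|) * ‖u - v‖ := by
  have e : szegoField α u - szegoField α v = (-Complex.I) •
      ((trilin u u (star u) - trilin v v (star v)) + ((α : ℂ) * (u - v) 0) • ell1Basis 0) := by
    simp only [szegoField, lp.coeFn_sub, Pi.sub_apply, mul_sub, sub_smul]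
    rw [← smul_sub]
    congr 1
    abel
  have h0 : ‖(u - v) 0‖ ≤ ‖u - v‖ := lp.norm_apply_le_norm (by simp) _ _
  rw [e, norm_smul, norm_neg, Complex.norm_I, one_mul, add_mul]
  refine (norm_add_le _ _).trans (add_le_add (norm_trilin_cubic_sub_le hu hv) ?_)
  rw [norm_smul, norm_ell1Basis, mul_one, norm_mul, Complex.norm_real, Real.norm_eq_abs]
  gcongr

theorem szegoField_zero (α : ℝ) : szegoField α 0 = 0 := by simp [szegoField]

/-- Solutions exist on every compact interval, given an a priori bound for the initial datum. -/
theorem exists_szego_solution_Icc (α : ℝ) (u₀ : Ell1) {M T : ℝ} (hT : 0 ≤ T) (hM0 : 0 ≤ M)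
    (hM : ‖ell1ToEll2 u₀‖ₑ + 2 * ∑' n, ‖hankelOp u₀ (ell2Basis n)‖ₑ ≤ ENNReal.ofReal M) :
    ∃ u : ℝ → Ell1, u 0 = u₀ ∧ IsTimeChangedSzego α (-T) T (fun _ => 1) u ∧
      ∀ t ∈ Set.Icc (-T) T, ‖u t‖ ≤ M := by
  have h0 : (0 : ℝ) ∈ Set.Icc (-T) T := ⟨by linarith, hT⟩
  set K := 3 * (M + 1) ^ 2 + |α| with hKdef
  have hK : 0 ≤ K := by positivity
  obtain ⟨u, hu0, hu⟩ := exists_cutoff_solution (fun _ => szegoField α) h0 u₀ (R := M + 1)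
    (K := K) (B := K * (M + 1)) hK (by positivity)
    (fun _ _ x y hx hy => szegoField_sub_norm_le hx hy)
    (fun _ _ x hx => by
      have := szegoField_sub_norm_le (α := α) (v := 0) hx (by rw [norm_zero]; positivity)
      rw [szegoField_zero, sub_zero, sub_zero] at this
      exact this.trans (by gcongr))
    (fun x => continuousOn_const)
  have hc : ContinuousOn u (Set.Icc (-T) T) := fun t ht => (hu t ht).continuousWithinAt
  -- The cut-off flow is a Szegő flow with variable speed, so the a priori bound `M` already
  -- applies. As the cutoff is `1` for norms up to `M`, the speed is `1`.
  have hts : IsTimeChangedSzego α (-T) T (fun t => cutoff (M + 1) ‖u t‖) u :=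
    ⟨(continuous_cutoff _).comp_continuousOn hc.norm, hu⟩
  have hb : ∀ t ∈ Set.Icc (-T) T, ‖u t‖ ≤ M := by
    intro t ht
    have := hts.enorm_le h0 ht
    rw [hu0] at this
    replace this := this.trans hM
    rwa [← ofReal_norm, ENNReal.ofReal_le_ofReal_iff hM0] at this
  refine ⟨u, hu0, ⟨continuousOn_const, fun t ht => ?_⟩, hb⟩
  have := hu t ht
  rwa [cutoff_eq_one (by linarith [hb t ht])] at this

/-- Global solutions of the `α`-Szegő equation on `Ell1`. -/
theorem exists_szego_solution (α : ℝ) (u₀ : Ell1) {M : ℝ} (hM0 : 0 ≤ M)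
    (hM : ‖ell1ToEll2 u₀‖ₑ + 2 * ∑' n, ‖hankelOp u₀ (ell2Basis n)‖ₑ ≤ ENNReal.ofReal M) :
    ∃ u : ℝ → Ell1, u 0 = u₀ ∧ (∀ t, HasDerivAt u (szegoField α (u t)) t) ∧
      (∀ t, ‖u t‖ ≤ M) ∧ (∀ t, ‖ell1ToEll2 (u t)‖ = ‖ell1ToEll2 u₀‖) ∧
      ∀ t, momentum (u t) = momentum u₀ := by
  choose v hv0 hv hvM using fun n : ℕ =>
    exists_szego_solution_Icc α u₀ (T := n + 1) (by positivity) hM0 hM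
  have hder (n : ℕ) : ∀ t ∈ Set.Ioo (-((n : ℝ) + 1)) (n + 1),
      HasDerivAt (v n) (szegoField α (v n t)) t := by
    intro t ht
    have := ((hv n).deriv t (Set.Ioo_subset_Icc_self ht)).hasDerivAt (Icc_mem_nhds ht.1 ht.2)
    rwa [one_smul] at this
  have hlip : LipschitzOnWith (Real.toNNReal (3 * M ^ 2 + |α|)) (szegoField α)
      (Metric.closedBall 0 M) := by
    refine LipschitzOnWith.of_dist_le_mul fun x hx y hy => ?_
    rw [mem_closedBall_zero_iff] at hx hy
    rw [dist_eq_norm, dist_eq_norm, Real.coe_toNNReal _ (by positivity)]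
    exact szegoField_sub_norm_le hx hy
  have hmono {n m : ℕ} (hnm : n ≤ m) :
      Set.EqOn (v n) (v m) (Set.Ioo (-((n : ℝ) + 1)) (n + 1)) := by
    have hcast : (n : ℝ) ≤ m := by exact_mod_cast hnm
    have hsub : Set.Ioo (-((n : ℝ) + 1)) (n + 1) ⊆ Set.Ioo (-((m : ℝ) + 1)) (m + 1) :=
      Set.Ioo_subset_Ioo (by linarith) (by linarith)
    refine ODE_solution_unique_of_mem_Ioo (v := fun _ => szegoField α)
      (s := fun _ => Metric.closedBall 0 M) (t₀ := 0) (fun _ _ => hlip)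
      ⟨by linarith [n.cast_nonneg (α := ℝ)], by positivity⟩ (fun t ht => ⟨hder n t ht, ?_⟩)
      (fun t ht => ⟨hder m t (hsub ht), ?_⟩) (by rw [hv0, hv0])
    · exact mem_closedBall_zero_iff.2 (hvM n t (Set.Ioo_subset_Icc_self ht))
    · exact mem_closedBall_zero_iff.2 (hvM m t (Set.Ioo_subset_Icc_self (hsub ht)))
  -- The index `⌈|t|⌉₊` selects an interval with `t` in its interior, so that two-sided derivatives
  -- pass to the glued solution.
  have hceil (t : ℝ) : t ∈ Set.Ioo (-((⌈|t|⌉₊ : ℝ) + 1)) (⌈|t|⌉₊ + 1) := by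
    have := Nat.le_ceil |t|
    exact abs_lt.1 (by linarith)
  have heq (n : ℕ) : Set.EqOn (fun t => v ⌈|t|⌉₊ t) (v n) (Set.Ioo (-((n : ℝ) + 1)) (n + 1)) := by
    intro t ht
    rcases le_total ⌈|t|⌉₊ n with h | h
    · exact hmono h (hceil t)
    · exact (hmono h ht).symm
  have hI (t : ℝ) := Set.Ioo_subset_Icc_self (hceil t)
  have h0 (t : ℝ) : (0 : ℝ) ∈ Set.Icc (-((⌈|t|⌉₊ : ℝ) + 1)) (⌈|t|⌉₊ + 1) := by
    constructor
    · linarith [(⌈|t|⌉₊).cast_nonneg (α := ℝ)]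
    · positivity
  refine ⟨fun t => v ⌈|t|⌉₊ t, hv0 _, fun t => ?_, fun t => hvM _ t (hI t), fun t => ?_,
    fun t => ?_⟩
  · exact (hder _ t (hceil t)).congr_of_eventuallyEq
      ((heq _).eventuallyEq_of_mem (Ioo_mem_nhds (hceil t).1 (hceil t).2))
  · rw [(hv _).norm_ell2_eq (hI t) (h0 t), hv0]
  · rw [(hv _).momentum_eq (h0 t) (hI t), hv0]

/-! ### Fourier coefficients and trigonometric polynomials in L². -/

/-- The `k`-th Fourier coefficient as a functional on `L²`. -/
noncomputable def coeffL2 (k : ℤ) : L2Circle →L[ℂ] ℂ := innerSL ℂ (fourierBasis k : L2Circle)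

theorem coeffL2_apply (k : ℤ) (u : L2Circle) : coeffL2 k u = fourierCoeff (u : S1 → ℂ) k := by
  rw [← fourierBasis_repr, HilbertBasis.repr_apply_apply]
  rfl

theorem L2Circle.ext_coeff {u v : L2Circle}
    (h : ∀ k, fourierCoeff (u : S1 → ℂ) k = fourierCoeff (v : S1 → ℂ) k) : u = v := by
  apply fourierBasis.repr.injective
  ext k
  rw [fourierBasis_repr, fourierBasis_repr, h]

theorem fourierCoeff_L2_sub (u v : L2Circle) (k : ℤ) :
    fourierCoeff ((u - v : L2Circle) : S1 → ℂ) k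
      = fourierCoeff (u : S1 → ℂ) k - fourierCoeff (v : S1 → ℂ) k := by
  simp only [← coeffL2_apply, map_sub]

/-- Continuous functions as elements of `L²`. -/
noncomputable abbrev contToL2 : C(S1, ℂ) →L[ℂ] L2Circle :=
  ContinuousMap.toLp (E := ℂ) 2 circleMeasure ℂ

theorem coeffL2_contToL2 (k : ℤ) (f : C(S1, ℂ)) :
    coeffL2 k (contToL2 f) = fourierCoeff (f : S1 → ℂ) k := by
  rw [coeffL2_apply]
  exact fourierCoeff_toLp f k

theorem fourierCoeff_fourier_apply (n k : ℤ) :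
    fourierCoeff (fourier n : C(S1, ℂ)) k = if k = n then 1 else 0 := by
  rw [fourierCoeff_fourier, Pi.single_apply]

/-- The partial sum of length `N` of the power series with coefficients `c`. -/
noncomputable def trigPoly (c : ℕ → ℂ) (N : ℕ) : C(S1, ℂ) :=
  ∑ a ∈ Finset.range N, c a • fourier (a : ℤ)

theorem trigPoly_apply (c : ℕ → ℂ) (N : ℕ) (x : S1) :
    trigPoly c N x = ∑ a ∈ Finset.range N, c a * fourier (a : ℤ) x := by
  simp [trigPoly, ContinuousMap.sum_apply]

theorem fourierCoeff_trigPoly (c : ℕ → ℂ) (N : ℕ) (k : ℤ) :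
    fourierCoeff (trigPoly c N : S1 → ℂ) k
      = ∑ a ∈ Finset.range N, if k = (a : ℤ) then c a else 0 := by
  rw [← coeffL2_contToL2]
  simp only [trigPoly, map_sum, map_smul, coeffL2_contToL2, fourierCoeff_fourier_apply,
    smul_eq_mul, mul_ite, mul_one, mul_zero]

theorem fourierCoeff_trigPoly_natCast (c : ℕ → ℂ) (N k : ℕ) :
    fourierCoeff (trigPoly c N : S1 → ℂ) (k : ℤ) = if k < N then c k else 0 := by
  simp [fourierCoeff_trigPoly]

theorem fourierCoeff_trigPoly_neg (c : ℕ → ℂ) (N : ℕ) {k : ℤ} (hk : k < 0) :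
    fourierCoeff (trigPoly c N : S1 → ℂ) k = 0 := by
  rw [fourierCoeff_trigPoly]
  refine Finset.sum_eq_zero fun a _ => if_neg (by omega)

theorem hasSum_nat_of_neg {E : Type*} [AddCommMonoid E] [TopologicalSpace E] {f : ℤ → E} {s : E}
    (h0 : ∀ k < 0, f k = 0) : HasSum (fun k : ℕ => f k) s ↔ HasSum f s := by
  refine Function.Injective.hasSum_iff Nat.cast_injective fun k hk => h0 k ?_
  by_contra h
  exact hk ⟨k.toNat, by simp; omega⟩

theorem summable_nat_of_neg {E : Type*} [AddCommMonoid E] [TopologicalSpace E] {f : ℤ → E}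
    (h0 : ∀ k < 0, f k = 0) : Summable (fun k : ℕ => f k) ↔ Summable f :=
  ⟨fun ⟨s, h⟩ => ⟨s, (hasSum_nat_of_neg h0).1 h⟩, fun ⟨s, h⟩ => ⟨s, (hasSum_nat_of_neg h0).2 h⟩⟩

/-! ### The L⁴ embedding with a weight weaker than that of `H^{1/2}`. -/

/-- The fractional weight `(1 + k) ^ (3/4)`. -/
noncomputable def quarterWeight (k : ℕ) : ℝ := (1 + (k : ℝ)) ^ (3 / 4 : ℝ)

theorem quarterWeight_pos (k : ℕ) : 0 < quarterWeight k := by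
  unfold quarterWeight; positivity

theorem summable_inv_quarterWeight_sq : Summable fun k => (quarterWeight k ^ 2)⁻¹ := by
  have h : Summable fun k : ℕ => 1 / ((k + 1 : ℕ) : ℝ) ^ (3 / 2 : ℝ) :=
    (summable_nat_add_iff 1).2 (Real.summable_one_div_nat_rpow.2 (by norm_num))
  refine h.congr fun k => ?_
  rw [quarterWeight, ← Real.rpow_natCast, ← Real.rpow_mul (by positivity), one_div]
  norm_num [add_comm]

/-- The constant in the `L⁴` embedding. -/
noncomputable def fourthConst : ℝ := ∑' k, (quarterWeight k ^ 2)⁻¹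

theorem fourthConst_nonneg : 0 ≤ fourthConst := tsum_nonneg fun _ => by positivity

/-- Cauchy–Schwarz with weights on the pairs `a + b = k`. The sum of `1 / (w a * w b)` over them is
bounded uniformly in `k`: the arithmetic–geometric inequality splits it into two sums of `1 / w²`,
convergent since `w² = (1 + k) ^ (3/2)`. -/
theorem norm_sq_convolution_le (c : ℕ → ℂ) (N : ℕ) (k : ℤ) :
    ‖∑ x ∈ Finset.range N ×ˢ Finset.range N,
        if k = ((x.1 + x.2 : ℕ) : ℤ) then c x.1 * c x.2 else 0‖ ^ 2
      ≤ ∑ x ∈ Finset.range N ×ˢ Finset.range N, if k = ((x.1 + x.2 : ℕ) : ℤ) then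
        fourthConst * ((quarterWeight x.1 * ‖c x.1‖ ^ 2) * (quarterWeight x.2 * ‖c x.2‖ ^ 2))
        else 0 := by
  set P := (Finset.range N ×ˢ Finset.range N).filter fun x : ℕ × ℕ => k = ((x.1 + x.2 : ℕ) : ℤ)
    with hP
  rw [← Finset.sum_filter, ← Finset.sum_filter, ← hP, ← Finset.mul_sum]
  have hmem {x : ℕ × ℕ} (hx : x ∈ P) : k = ((x.1 + x.2 : ℕ) : ℤ) := (Finset.mem_filter.1 hx).2
  have hD1 : ∑ x ∈ P, (quarterWeight x.1 ^ 2)⁻¹ ≤ fourthConst := by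
    rw [← Finset.sum_image (s := P) (g := Prod.fst) (f := fun a => (quarterWeight a ^ 2)⁻¹)]
    · exact summable_inv_quarterWeight_sq.sum_le_tsum _ fun _ _ => by positivity
    · intro x hx y hy h
      have h1 := hmem hx
      have h2 := hmem hy
      exact Prod.ext h (by omega)
  have hD2 : ∑ x ∈ P, (quarterWeight x.2 ^ 2)⁻¹ ≤ fourthConst := by
    rw [← Finset.sum_image (s := P) (g := Prod.snd) (f := fun a => (quarterWeight a ^ 2)⁻¹)]
    · exact summable_inv_quarterWeight_sq.sum_le_tsum _ fun _ _ => by positivity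
    · intro x hx y hy h
      have h1 := hmem hx
      have h2 := hmem hy
      exact Prod.ext (by omega) h
  have hD : ∑ x ∈ P, (quarterWeight x.1 * quarterWeight x.2)⁻¹ ≤ fourthConst := by
    have h : ∀ x ∈ P, (quarterWeight x.1 * quarterWeight x.2)⁻¹
        ≤ ((quarterWeight x.1 ^ 2)⁻¹ + (quarterWeight x.2 ^ 2)⁻¹) / 2 := by
      intro x _
      rw [mul_inv, ← inv_pow, ← inv_pow]
      nlinarith [sq_nonneg ((quarterWeight x.1)⁻¹ - (quarterWeight x.2)⁻¹)]
    refine (Finset.sum_le_sum h).trans ?_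
    rw [← Finset.sum_div, Finset.sum_add_distrib]
    linarith
  have hcs := Finset.sum_mul_sq_le_sq_mul_sq P
    (fun x => Real.sqrt ((quarterWeight x.1 * quarterWeight x.2)⁻¹))
    (fun x => Real.sqrt (quarterWeight x.1 * quarterWeight x.2) * (‖c x.1‖ * ‖c x.2‖))
  have hpos (x : ℕ × ℕ) : 0 < quarterWeight x.1 * quarterWeight x.2 :=
    mul_pos (quarterWeight_pos _) (quarterWeight_pos _)
  have e1 : ∀ x ∈ P, Real.sqrt ((quarterWeight x.1 * quarterWeight x.2)⁻¹) *
      (Real.sqrt (quarterWeight x.1 * quarterWeight x.2) * (‖c x.1‖ * ‖c x.2‖))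
      = ‖c x.1 * c x.2‖ := by
    intro x _
    rw [← mul_assoc, ← Real.sqrt_mul (inv_nonneg.2 (hpos x).le), inv_mul_cancel₀ (hpos x).ne',
      Real.sqrt_one, one_mul, norm_mul]
  rw [Finset.sum_congr rfl e1] at hcs
  calc ‖∑ x ∈ P, c x.1 * c x.2‖ ^ 2 ≤ (∑ x ∈ P, ‖c x.1 * c x.2‖) ^ 2 := by
        gcongr; exact norm_sum_le _ _
    _ ≤ _ := hcs
    _ ≤ fourthConst * ∑ x ∈ P, (quarterWeight x.1 * ‖c x.1‖ ^ 2)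
        * (quarterWeight x.2 * ‖c x.2‖ ^ 2) := by
      refine mul_le_mul ?_ (le_of_eq ?_) (Finset.sum_nonneg fun _ _ => by positivity)
        fourthConst_nonneg
      · refine le_trans (le_of_eq (Finset.sum_congr rfl fun x _ => ?_)) hD
        exact Real.sq_sqrt (inv_nonneg.2 (hpos x).le)
      · refine Finset.sum_congr rfl fun x _ => ?_
        rw [mul_pow, Real.sq_sqrt (hpos x).le]
        ring

theorem fourierCoeff_trigPoly_sq (c : ℕ → ℂ) (N : ℕ) (k : ℤ) :
    fourierCoeff (trigPoly c N * trigPoly c N : C(S1, ℂ)) k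
      = ∑ x ∈ Finset.range N ×ˢ Finset.range N,
        if k = ((x.1 + x.2 : ℕ) : ℤ) then c x.1 * c x.2 else 0 := by
  have e : trigPoly c N * trigPoly c N = ∑ x ∈ Finset.range N ×ˢ Finset.range N,
      (c x.1 * c x.2) • fourier (((x.1 + x.2 : ℕ) : ℤ)) := by
    ext x
    rw [ContinuousMap.mul_apply, trigPoly_apply, Finset.sum_mul_sum, ← Finset.sum_product',
      ContinuousMap.sum_apply]
    refine Finset.sum_congr rfl fun y _ => ?_
    rw [ContinuousMap.smul_apply, Nat.cast_add, fourier_add, smul_eq_mul]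
    ring
  rw [← coeffL2_contToL2, e]
  simp only [map_sum, map_smul, coeffL2_contToL2, fourierCoeff_fourier_apply,
    smul_eq_mul, mul_ite, mul_one, mul_zero]

/-- The fourth power of the L⁴ norm is the squared L² norm of the square, computed by Parseval.
Summing the convolution bound over `k` decouples the two factors. -/
theorem integral_trigPoly_fourth_le (c : ℕ → ℂ) (N : ℕ) :
    ∫ x, ‖trigPoly c N x‖ ^ 4 ∂circleMeasure
      ≤ fourthConst * (∑ a ∈ Finset.range N, quarterWeight a * ‖c a‖ ^ 2) ^ 2 := by
  have h1 := hasSum_sq_fourierCoeff (contToL2 (trigPoly c N * trigPoly c N))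
  simp only [← coeffL2_apply, coeffL2_contToL2, fourierCoeff_trigPoly_sq] at h1
  have h2 : HasSum (fun k : ℤ => ∑ x ∈ Finset.range N ×ˢ Finset.range N,
      if k = ((x.1 + x.2 : ℕ) : ℤ) then
        fourthConst * ((quarterWeight x.1 * ‖c x.1‖ ^ 2) * (quarterWeight x.2 * ‖c x.2‖ ^ 2))
        else 0) (∑ x ∈ Finset.range N ×ˢ Finset.range N,
        fourthConst * ((quarterWeight x.1 * ‖c x.1‖ ^ 2) * (quarterWeight x.2 * ‖c x.2‖ ^ 2))) :=
    hasSum_sum fun x _ => hasSum_ite_eq _ _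
  have h3 := hasSum_le (fun k => norm_sq_convolution_le c N k) h1 h2
  rw [← Finset.mul_sum] at h3
  rw [sq (∑ a ∈ _, _), Finset.sum_mul_sum, ← Finset.sum_product']
  refine le_trans (le_of_eq (integral_congr_ae ?_)) h3
  filter_upwards [ContinuousMap.coeFn_toLp (p := 2) (𝕜 := ℂ) circleMeasure
    (trigPoly c N * trigPoly c N)] with x hx
  rw [hx, ContinuousMap.mul_apply, norm_mul]
  ring

/-- The Fourier coefficients with nonnegative index. -/
noncomputable def natCoeff (u : L2Circle) (k : ℕ) : ℂ := fourierCoeff (u : S1 → ℂ) (k : ℤ)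

theorem natCoeff_sub (u v : L2Circle) (k : ℕ) :
    natCoeff (u - v) k = natCoeff u k - natCoeff v k := fourierCoeff_L2_sub u v k

/-- The function has no negative frequencies. -/
def NonnegFreq (u : L2Circle) : Prop := ∀ k : ℤ, k < 0 → fourierCoeff (u : S1 → ℂ) k = 0

theorem NonnegFreq.sub {u v : L2Circle} (hu : NonnegFreq u) (hv : NonnegFreq v) :
    NonnegFreq (u - v) := fun k hk => by rw [fourierCoeff_L2_sub, hu k hk, hv k hk, sub_zero]

theorem NonnegFreq.ext {u v : L2Circle} (hu : NonnegFreq u) (hv : NonnegFreq v)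
    (h : ∀ k, natCoeff u k = natCoeff v k) : u = v := by
  refine L2Circle.ext_coeff fun k => ?_
  rcases lt_or_ge k 0 with hk | hk
  · rw [hu k hk, hv k hk]
  · lift k to ℕ using hk
    exact h k

theorem NonnegFreq.tendsto_trigPoly {u : L2Circle} (hu : NonnegFreq u) :
    Tendsto (fun N => contToL2 (trigPoly (natCoeff u) N)) atTop (𝓝 u) := by
  have h := hasSum_fourier_series_L2 u
  rw [← hasSum_nat_of_neg fun k hk => by rw [hu k hk, zero_smul]] at h
  refine h.tendsto_sum_nat.congr fun N => ?_
  rw [trigPoly, map_sum]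
  refine Finset.sum_congr rfl fun a _ => ?_
  rw [map_smul]
  rfl

theorem nonnegFreq_contToL2_trigPoly (c : ℕ → ℂ) (N : ℕ) :
    NonnegFreq (contToL2 (trigPoly c N)) := fun k hk => by
  rw [← coeffL2_apply, coeffL2_contToL2, fourierCoeff_trigPoly_neg c N hk]

theorem natCoeff_contToL2_trigPoly (c : ℕ → ℂ) (N k : ℕ) :
    natCoeff (contToL2 (trigPoly c N)) k = if k < N then c k else 0 := by
  rw [natCoeff, ← coeffL2_apply, coeffL2_contToL2, fourierCoeff_trigPoly_natCast]

/-- The embedding of a fractional Sobolev space into `L⁴`. -/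
theorem NonnegFreq.integral_fourth_le {u : L2Circle} (hu : NonnegFreq u)
    (hs : Summable fun k => quarterWeight k * ‖natCoeff u k‖ ^ 2) :
    Integrable (fun x => ‖u x‖ ^ 4) circleMeasure ∧ ∫ x, ‖u x‖ ^ 4 ∂circleMeasure
      ≤ fourthConst * (∑' k, quarterWeight k * ‖natCoeff u k‖ ^ 2) ^ 2 := by
  set B := fourthConst * (∑' k, quarterWeight k * ‖natCoeff u k‖ ^ 2) ^ 2 with hB
  have hB0 : 0 ≤ B := mul_nonneg fourthConst_nonneg (sq_nonneg _)
  have hN (N : ℕ) : ∫⁻ x, ENNReal.ofReal (‖trigPoly (natCoeff u) N x‖ ^ 4) ∂circleMeasure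
      ≤ ENNReal.ofReal B := by
    rw [← ofReal_integral_eq_lintegral_ofReal]
    · refine ENNReal.ofReal_le_ofReal ((integral_trigPoly_fourth_le _ N).trans ?_)
      refine mul_le_mul_of_nonneg_left (pow_le_pow_left₀ (Finset.sum_nonneg fun a _ => ?_)
        (hs.sum_le_tsum _ fun a _ => ?_) 2) fourthConst_nonneg
      · exact mul_nonneg (quarterWeight_pos a).le (sq_nonneg _)
      · exact mul_nonneg (quarterWeight_pos a).le (sq_nonneg _)
    · exact Continuous.integrable_of_hasCompactSupport (by fun_prop)
        (HasCompactSupport.of_compactSpace _)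
    · exact ae_of_all _ fun x => by positivity
  -- L² convergence gives almost everywhere convergence along a subsequence, and Fatou's lemma
  -- carries the uniform bound to the limit.
  obtain ⟨ns, -, hns⟩ := (tendstoInMeasure_of_tendsto_Lp hu.tendsto_trigPoly).exists_seq_tendsto_ae
  have hae : ∀ᵐ x ∂circleMeasure, ∀ N, contToL2 (trigPoly (natCoeff u) N) x
      = trigPoly (natCoeff u) N x :=
    ae_all_iff.2 fun N => ContinuousMap.coeFn_toLp (p := 2) (𝕜 := ℂ) circleMeasure _
  have hlim : ∫⁻ x, ENNReal.ofReal (‖u x‖ ^ 4) ∂circleMeasure ≤ ENNReal.ofReal B := by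
    calc _ = ∫⁻ x, liminf (fun i => ENNReal.ofReal (‖trigPoly (natCoeff u) (ns i) x‖ ^ 4)) atTop
          ∂circleMeasure := by
          refine lintegral_congr_ae ?_
          filter_upwards [hns, hae] with x hx hx'
          simp only [hx'] at hx
          exact (ENNReal.tendsto_ofReal (hx.norm.pow 4)).liminf_eq.symm
      _ ≤ liminf (fun i => ∫⁻ x, ENNReal.ofReal (‖trigPoly (natCoeff u) (ns i) x‖ ^ 4)
          ∂circleMeasure) atTop := lintegral_liminf_le fun i => by fun_prop
      _ ≤ liminf (fun _ : ℕ => ENNReal.ofReal B) atTop :=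
          liminf_le_liminf (Eventually.of_forall fun i => hN _)
      _ = _ := by simp
  have hmeas : AEStronglyMeasurable (fun x => ‖u x‖ ^ 4) circleMeasure :=
    (Lp.aestronglyMeasurable u).norm.pow 4
  have h0 : 0 ≤ᵐ[circleMeasure] fun x => ‖u x‖ ^ 4 := ae_of_all _ fun x => by positivity
  refine ⟨⟨hmeas, ?_⟩, ?_⟩
  · rw [hasFiniteIntegral_iff_ofReal h0]
    exact hlim.trans_lt ENNReal.ofReal_lt_top
  · rw [integral_eq_lintegral_of_nonneg_ae h0 hmeas]
    exact ENNReal.toReal_le_of_le_ofReal hB0 hlim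

/-- The energy `∑ (1 + k) |û(k)|²` is finite. -/
def FiniteEnergy (u : L2Circle) : Prop :=
  NonnegFreq u ∧ Summable fun k : ℕ => (1 + (k : ℝ)) * ‖natCoeff u k‖ ^ 2

/-- The energy `∑ (1 + k) |û(k)|²`, equivalent to the square of the `H^{1/2}` norm. -/
noncomputable def energy (u : L2Circle) : ℝ := ∑' k : ℕ, (1 + (k : ℝ)) * ‖natCoeff u k‖ ^ 2

theorem quarterWeight_le (k : ℕ) : quarterWeight k ≤ 1 + k := by
  unfold quarterWeight
  have h : (1 : ℝ) ≤ 1 + k := by linarith [k.cast_nonneg (α := ℝ)]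
  simpa using Real.rpow_le_rpow_of_exponent_le h (show (3 / 4 : ℝ) ≤ 1 by norm_num)

/-- For frequencies at least `N` the weights differ by a factor `N ^ (1/4)`. -/
theorem quarterWeight_le_of_le {N k : ℕ} (hN : 0 < N) (h : N ≤ k) :
    quarterWeight k ≤ (N : ℝ) ^ (-(1 / 4) : ℝ) * (1 + k) := by
  have hN' : (0 : ℝ) < N := by exact_mod_cast hN
  have hk : (N : ℝ) ≤ 1 + k := by
    have : (N : ℝ) ≤ k := by exact_mod_cast h
    linarith
  have e : (1 + (k : ℝ)) ^ (3 / 4 : ℝ) = (1 + (k : ℝ)) ^ (-(1 / 4) : ℝ) * (1 + k) := by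
    nth_rw 3 [← Real.rpow_one (1 + (k : ℝ))]
    rw [← Real.rpow_add (by positivity)]
    norm_num
  rw [quarterWeight, e]
  gcongr ?_ * _
  exact Real.rpow_le_rpow_of_nonpos hN' hk (by norm_num)

namespace FiniteEnergy
variable {u v : L2Circle}

theorem energy_nonneg (u : L2Circle) : 0 ≤ energy u := tsum_nonneg fun k => by positivity

theorem sub (hu : FiniteEnergy u) (hv : FiniteEnergy v) :
    FiniteEnergy (u - v) ∧ energy (u - v) ≤ 2 * energy u + 2 * energy v := by
  have h : ∀ k : ℕ, (1 + (k : ℝ)) * ‖natCoeff (u - v) k‖ ^ 2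
      ≤ 2 * ((1 + (k : ℝ)) * ‖natCoeff u k‖ ^ 2) + 2 * ((1 + (k : ℝ)) * ‖natCoeff v k‖ ^ 2) := by
    intro k
    have h1 : ‖natCoeff (u - v) k‖ ^ 2 ≤ 2 * ‖natCoeff u k‖ ^ 2 + 2 * ‖natCoeff v k‖ ^ 2 := by
      rw [natCoeff_sub]
      have := norm_sub_le (natCoeff u k) (natCoeff v k)
      nlinarith [norm_nonneg (natCoeff u k - natCoeff v k),
        sq_nonneg (‖natCoeff u k‖ - ‖natCoeff v k‖)]
    nlinarith [k.cast_nonneg (α := ℝ)]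
  have hs := (hu.2.mul_left 2).add (hv.2.mul_left 2)
  have hs' := Summable.of_nonneg_of_le (fun k => by positivity) h hs
  refine ⟨⟨hu.1.sub hv.1, hs'⟩, (hs'.tsum_le_tsum h hs).trans (le_of_eq ?_)⟩
  rw [(hu.2.mul_left 2).tsum_add (hv.2.mul_left 2), tsum_mul_left, tsum_mul_left]
  rfl

theorem summable_quarterWeight (hu : FiniteEnergy u) :
    Summable fun k => quarterWeight k * ‖natCoeff u k‖ ^ 2 :=
  Summable.of_nonneg_of_le (fun k => mul_nonneg (quarterWeight_pos k).le (sq_nonneg _))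
    (fun k => by gcongr; exact quarterWeight_le k) hu.2

theorem integral_fourth_le (hu : FiniteEnergy u) :
    Integrable (fun x => ‖u x‖ ^ 4) circleMeasure ∧ ∫ x, ‖u x‖ ^ 4 ∂circleMeasure
      ≤ fourthConst * energy u ^ 2 := by
  obtain ⟨h1, h2⟩ := hu.1.integral_fourth_le hu.summable_quarterWeight
  refine ⟨h1, h2.trans ?_⟩
  refine mul_le_mul_of_nonneg_left (pow_le_pow_left₀ (tsum_nonneg fun k =>
    mul_nonneg (quarterWeight_pos k).le (sq_nonneg _)) ?_ 2) fourthConst_nonneg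
  exact hu.summable_quarterWeight.tsum_le_tsum (fun k => by gcongr; exact quarterWeight_le k) hu.2

/-- The energy controls the sup norm of partial sums up to a logarithm. -/
theorem norm_trigPoly_sq_le (hu : FiniteEnergy u) (N : ℕ) (x : S1) :
    ‖trigPoly (natCoeff u) N x‖ ^ 2 ≤ (∑ k ∈ Finset.range N, (1 + (k : ℝ))⁻¹) * energy u := by
  have h1 : ‖trigPoly (natCoeff u) N x‖ ≤ ∑ k ∈ Finset.range N, ‖natCoeff u k‖ := by
    rw [trigPoly_apply]
    refine (norm_sum_le _ _).trans (le_of_eq (Finset.sum_congr rfl fun k _ => ?_))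
    rw [norm_mul, fourier_apply, Circle.norm_coe, mul_one]
  have h2 : (∑ k ∈ Finset.range N, ‖natCoeff u k‖) ^ 2
      ≤ (∑ k ∈ Finset.range N, (1 + (k : ℝ))⁻¹)
        * ∑ k ∈ Finset.range N, (1 + (k : ℝ)) * ‖natCoeff u k‖ ^ 2 := by
    refine Finset.sum_sq_le_sum_mul_sum_of_sq_le_mul _ (fun k _ => by positivity)
      (fun k _ => by positivity) fun k _ => le_of_eq ?_
    field_simp
  refine (pow_le_pow_left₀ (norm_nonneg _) h1 2).trans (h2.trans ?_)
  gcongr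
  exact hu.2.sum_le_tsum _ fun k _ => by positivity

theorem integral_norm_sq (hu : NonnegFreq u) :
    HasSum (fun k => ‖natCoeff u k‖ ^ 2) (∫ x, ‖u x‖ ^ 2 ∂circleMeasure) := by
  have h := hasSum_sq_fourierCoeff u
  rwa [← hasSum_nat_of_neg fun k hk => by simp [hu k hk]] at h

/-- The part of an `L²` function with frequencies at least `N`. -/
theorem high_fourth_le (hu : FiniteEnergy u) {N : ℕ} (hN : 0 < N) :
    Integrable (fun x => ‖u x - trigPoly (natCoeff u) N x‖ ^ 4) circleMeasure ∧
      ∫ x, ‖u x - trigPoly (natCoeff u) N x‖ ^ 4 ∂circleMeasure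
        ≤ fourthConst * ((N : ℝ) ^ (-(1 / 4) : ℝ) * energy u) ^ 2 := by
  set h : L2Circle := u - contToL2 (trigPoly (natCoeff u) N) with hdef
  have hh : NonnegFreq h := hu.1.sub (nonnegFreq_contToL2_trigPoly _ _)
  have hc (k : ℕ) : natCoeff h k = if k < N then 0 else natCoeff u k := by
    rw [hdef, natCoeff_sub, natCoeff_contToL2_trigPoly]
    split_ifs <;> simp
  have hle (k : ℕ) : quarterWeight k * ‖natCoeff h k‖ ^ 2
      ≤ (N : ℝ) ^ (-(1 / 4) : ℝ) * ((1 + k) * ‖natCoeff u k‖ ^ 2) := by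
    rw [hc]
    split_ifs with hk
    · simp only [norm_zero, ne_eq, OfNat.ofNat_ne_zero, not_false_eq_true, zero_pow, mul_zero]
      positivity
    · rw [← mul_assoc]
      gcongr
      exact quarterWeight_le_of_le hN (not_lt.1 hk)
  have hs : Summable fun k => quarterWeight k * ‖natCoeff h k‖ ^ 2 :=
    Summable.of_nonneg_of_le (fun k => mul_nonneg (quarterWeight_pos k).le (sq_nonneg _)) hle
      (hu.2.mul_left _)
  have hae : (fun x => ‖h x‖ ^ 4) =ᵐ[circleMeasure]
      fun x => ‖u x - trigPoly (natCoeff u) N x‖ ^ 4 := by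
    filter_upwards [Lp.coeFn_sub u (contToL2 (trigPoly (natCoeff u) N)),
      ContinuousMap.coeFn_toLp (p := 2) (𝕜 := ℂ) circleMeasure (trigPoly (natCoeff u) N)]
      with x h1 h2
    rw [hdef, h1, Pi.sub_apply, h2]
  obtain ⟨h1, h2⟩ := hh.integral_fourth_le hs
  refine ⟨h1.congr hae, ?_⟩
  rw [← integral_congr_ae hae]
  refine h2.trans (mul_le_mul_of_nonneg_left (pow_le_pow_left₀ (tsum_nonneg fun k =>
    mul_nonneg (quarterWeight_pos k).le (sq_nonneg _)) ?_ 2) fourthConst_nonneg)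
  rw [energy, ← tsum_mul_left]
  exact hs.tsum_le_tsum hle (hu.2.mul_left _)

end FiniteEnergy

/-! ### The cubic term and the logarithmic estimate for differences. -/

theorem norm_cubic_sub_le (a b : ℂ) :
    ‖((‖a‖ ^ 2 : ℝ) : ℂ) * a - ((‖b‖ ^ 2 : ℝ) : ℂ) * b‖
      ≤ 2 * (‖a‖ ^ 2 + ‖b‖ ^ 2) * ‖a - b‖ := by
  have e : ((‖a‖ ^ 2 : ℝ) : ℂ) * a - ((‖b‖ ^ 2 : ℝ) : ℂ) * b
      = ((‖a‖ ^ 2 : ℝ) : ℂ) * (a - b) + (((‖a‖ - ‖b‖) * (‖a‖ + ‖b‖) : ℝ) : ℂ) * b := by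
    push_cast; ring
  have h := abs_norm_sub_norm_le a b
  have ha := norm_nonneg a
  have hb := norm_nonneg b
  rw [e]
  refine (norm_add_le _ _).trans ?_
  rw [norm_mul, norm_mul, Complex.norm_real, Complex.norm_real, Real.norm_eq_abs, Real.norm_eq_abs,
    abs_mul, abs_of_nonneg (sq_nonneg ‖a‖), abs_of_nonneg (add_nonneg ha hb)]
  have h1 : |‖a‖ - ‖b‖| * (‖a‖ + ‖b‖) * ‖b‖ ≤ ‖a - b‖ * (‖a‖ + ‖b‖) * ‖b‖ := by gcongr
  nlinarith [mul_nonneg (norm_nonneg (a - b)) (sq_nonneg (‖a‖ - ‖b‖)),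
    mul_nonneg (norm_nonneg (a - b)) (sq_nonneg ‖a‖),
    mul_nonneg (norm_nonneg (a - b)) (sq_nonneg ‖b‖)]

theorem FiniteEnergy.integrable_cubic {u : L2Circle} (hu : FiniteEnergy u) :
    Integrable (cubic u) circleMeasure := by
  have h2 : Integrable (fun x => ‖u x‖ ^ 2) circleMeasure := (Lp.memLp u).integrable_norm_pow' 
  have hm := Lp.aestronglyMeasurable u
  refine (h2.add hu.integral_fourth_le.1).mono' ?_ (ae_of_all _ fun x => ?_)
  · exact (Complex.continuous_ofReal.comp_aestronglyMeasurable (hm.norm.pow 2)).mul hm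
  · rw [cubic, norm_mul, Complex.norm_real, Real.norm_eq_abs, abs_of_nonneg (sq_nonneg _),
      Pi.add_apply]
    nlinarith [sq_nonneg (‖u x‖ ^ 2 - ‖u x‖), norm_nonneg (u x), sq_nonneg (‖u x‖ - 1)]

/-- Partial sums of the harmonic series. -/
noncomputable def harmonicSum (N : ℕ) : ℝ := ∑ k ∈ Finset.range N, (1 + (k : ℝ))⁻¹

theorem harmonicSum_nonneg (N : ℕ) : 0 ≤ harmonicSum N :=
  Finset.sum_nonneg fun _ _ => by positivity

theorem one_le_harmonicSum {N : ℕ} (hN : 0 < N) : 1 ≤ harmonicSum N := by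
  have := Finset.single_le_sum (f := fun k : ℕ => (1 + (k : ℝ))⁻¹) (s := Finset.range N)
    (fun _ _ => by positivity) (Finset.mem_range.2 hN)
  simpa [harmonicSum] using this

theorem harmonicSum_le (N : ℕ) : harmonicSum N ≤ 1 + Real.log N := by
  have h := harmonic_le_one_add_log N
  refine le_trans (le_of_eq ?_) h
  simp [harmonicSum, harmonic, add_comm]

/-- The mass `∑_{k < N} |û(k)|²` of the low frequencies. -/
noncomputable def lowMass (N : ℕ) (u : L2Circle) : ℝ := ∑ k ∈ Finset.range N, ‖natCoeff u k‖ ^ 2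

theorem lowMass_nonneg (N : ℕ) (u : L2Circle) : 0 ≤ lowMass N u :=
  Finset.sum_nonneg fun _ _ => by positivity

/-- Modes from `N` on are bounded with `1 ≤ quarterWeight k`. The rate `N ^ (-1/4)` is not optimal
for L², but matches the L⁴ tail. -/
theorem FiniteEnergy.integral_sq_le {u : L2Circle} (hu : FiniteEnergy u) {N : ℕ} (hN : 0 < N) :
    ∫ x, ‖u x‖ ^ 2 ∂circleMeasure ≤ lowMass N u + (N : ℝ) ^ (-(1 / 4) : ℝ) * energy u := by
  have h1 := FiniteEnergy.integral_norm_sq hu.1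
  have h2 : HasSum (fun k => if k ∈ Finset.range N then ‖natCoeff u k‖ ^ 2 else 0)
      (lowMass N u) := by
    rw [lowMass, ← Finset.sum_congr rfl fun k hk => if_pos hk]
    exact hasSum_sum_of_ne_finset_zero fun k hk => if_neg hk
  refine hasSum_le (fun k => ?_) h1 (h2.add (hu.2.hasSum.mul_left ((N : ℝ) ^ (-(1 / 4) : ℝ))))
  have hnn : 0 ≤ (N : ℝ) ^ (-(1 / 4) : ℝ) * ((1 + (k : ℝ)) * ‖natCoeff u k‖ ^ 2) := by positivity
  split_ifs with hk
  · linarith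
  · rw [Finset.mem_range, not_lt] at hk
    have hw : 1 ≤ quarterWeight k := by
      unfold quarterWeight
      exact Real.one_le_rpow (by linarith [k.cast_nonneg (α := ℝ)]) (by norm_num)
    have := hw.trans (quarterWeight_le_of_le hN hk)
    rw [← mul_assoc, zero_add]
    nlinarith [sq_nonneg ‖natCoeff u k‖]

theorem integral_trigPoly_sq (u : L2Circle) (N : ℕ) :
    ∫ x, ‖trigPoly (natCoeff u) N x‖ ^ 2 ∂circleMeasure = lowMass N u := by
  have h1 := FiniteEnergy.integral_norm_sq (nonnegFreq_contToL2_trigPoly (natCoeff u) N)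
  have hae : (fun x => ‖contToL2 (trigPoly (natCoeff u) N) x‖ ^ 2) =ᵐ[circleMeasure]
      fun x => ‖trigPoly (natCoeff u) N x‖ ^ 2 := by
    filter_upwards [ContinuousMap.coeFn_toLp (p := 2) (𝕜 := ℂ) circleMeasure
      (trigPoly (natCoeff u) N)] with x hx
    rw [hx]
  rw [← integral_congr_ae hae, ← h1.tsum_eq, tsum_eq_sum (s := Finset.range N)]
  · refine Finset.sum_congr rfl fun k hk => ?_
    rw [natCoeff_contToL2_trigPoly, if_pos (Finset.mem_range.1 hk)]
  · intro k hk
    rw [natCoeff_contToL2_trigPoly, if_neg (fun h => hk (Finset.mem_range.2 h))]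
    simp

theorem FiniteEnergy.trigPoly_fourth_le {u : L2Circle} (hu : FiniteEnergy u) (N : ℕ) :
    ∫ x, ‖trigPoly (natCoeff u) N x‖ ^ 4 ∂circleMeasure ≤ fourthConst * energy u ^ 2 := by
  refine (integral_trigPoly_fourth_le _ N).trans ?_
  have h0 (k : ℕ) : 0 ≤ quarterWeight k * ‖natCoeff u k‖ ^ 2 :=
    mul_nonneg (quarterWeight_pos k).le (sq_nonneg _)
  refine mul_le_mul_of_nonneg_left (pow_le_pow_left₀ (Finset.sum_nonneg fun k _ => h0 k) ?_ 2)
    fourthConst_nonneg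
  refine (hu.summable_quarterWeight.sum_le_tsum _ fun k _ => h0 k).trans ?_
  exact hu.summable_quarterWeight.tsum_le_tsum (fun k => by gcongr; exact quarterWeight_le k) hu.2

/-- The pairing of the difference of two cubic terms with the low frequencies of the difference
grows only logarithmically with the frequency cutoff. -/
theorem norm_integral_cubic_sub_le {u v : L2Circle} (hu : FiniteEnergy u) (hv : FiniteEnergy v)
    {S : ℝ} (hS : 0 ≤ S) (huS : energy u ≤ S) (hvS : energy v ≤ S) {N : ℕ} (hN : 0 < N) :
    ‖∫ x, (cubic u x - cubic v x) * star (trigPoly (natCoeff (u - v)) N x) ∂circleMeasure‖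
      ≤ 8 * S * harmonicSum N * lowMass N (u - v)
        + (16 * S ^ 2 * harmonicSum N + 68 * fourthConst * S ^ 2) * (N : ℝ) ^ (-(1 / 4) : ℝ) := by
  obtain ⟨hw, hwS⟩ := hu.sub hv
  set w := u - v with hwdef
  have hwS' : energy w ≤ 4 * S := by linarith
  set p := trigPoly (natCoeff w) N
  set q := (N : ℝ) ^ (-(1 / 4) : ℝ) with hq
  have hq0 : 0 < q := by have : (0 : ℝ) < N := by exact_mod_cast hN
                         positivity
  set H := harmonicSum N
  have hH := harmonicSum_nonneg N
  have hD := fourthConst_nonneg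
  set lu := trigPoly (natCoeff u) N
  set lv := trigPoly (natCoeff v) N
  have hpt : ∀ᵐ x ∂circleMeasure, ‖(cubic u x - cubic v x) * star (p x)‖
      ≤ 4 * H * S * (‖w x‖ ^ 2 + ‖p x‖ ^ 2)
        + (2 * q⁻¹ * (‖u x - lu x‖ ^ 4 + ‖v x - lv x‖ ^ 4)
          + 2 * q * (‖w x‖ ^ 4 + ‖p x‖ ^ 4)) := by
    filter_upwards [Lp.coeFn_sub u v] with x hx
    have hx' : ‖u x - v x‖ = ‖w x‖ := by rw [hwdef, hx, Pi.sub_apply]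
    have h1 := norm_cubic_sub_le (u x) (v x)
    rw [hx'] at h1
    rw [norm_mul, norm_star]
    -- Here `l` is the low frequency part, whose sup norm squared is at most `H * S`; the remainder
    -- `a - l` is only small in L⁴.
    have tri (a l : ℂ) (hl : ‖l‖ ^ 2 ≤ H * S) : ‖a‖ ^ 2 ≤ 2 * (H * S) + 2 * ‖a - l‖ ^ 2 := by
      have := norm_sub_norm_le a l
      have h3 : ‖a‖ ≤ ‖l‖ + ‖a - l‖ := by linarith
      nlinarith [norm_nonneg a, norm_nonneg l, norm_nonneg (a - l), sq_nonneg (‖l‖ - ‖a - l‖)]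
    have hlu := tri (u x) (lu x) ((hu.norm_trigPoly_sq_le N x).trans
      (mul_le_mul_of_nonneg_left huS hH))
    have hlv := tri (v x) (lv x) ((hv.norm_trigPoly_sq_le N x).trans
      (mul_le_mul_of_nonneg_left hvS hH))
    have hm : 0 ≤ ‖w x‖ * ‖p x‖ := by positivity
    -- The weight `q` balances the two sides: the fourth powers of the high parts integrate to order
    -- `q ^ 2`, so division by `q` leaves order `q`, the same as the other term.
    have amgm (e : ℝ) : 4 * e ^ 2 * (‖w x‖ * ‖p x‖)
        ≤ 2 * q⁻¹ * e ^ 4 + 2 * q * (‖w x‖ * ‖p x‖) ^ 2 := by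
      have h5 : 0 ≤ 2 * q⁻¹ * (e ^ 2 - q * (‖w x‖ * ‖p x‖)) ^ 2 := by positivity
      have h6 : 2 * q⁻¹ * (e ^ 2 - q * (‖w x‖ * ‖p x‖)) ^ 2
          = 2 * q⁻¹ * e ^ 4 + 2 * q * (‖w x‖ * ‖p x‖) ^ 2 - 4 * e ^ 2 * (‖w x‖ * ‖p x‖) := by
        field_simp
        ring
      linarith
    have h7 : ‖cubic u x - cubic v x‖ * ‖p x‖
        ≤ 2 * (‖u x‖ ^ 2 + ‖v x‖ ^ 2) * (‖w x‖ * ‖p x‖) := by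
      rw [← mul_assoc]
      exact mul_le_mul_of_nonneg_right h1 (norm_nonneg _)
    have h8 : 2 * (‖u x‖ ^ 2 + ‖v x‖ ^ 2) * (‖w x‖ * ‖p x‖)
        ≤ (8 * (H * S) + 4 * ‖u x - lu x‖ ^ 2 + 4 * ‖v x - lv x‖ ^ 2) * (‖w x‖ * ‖p x‖) :=
      mul_le_mul_of_nonneg_right (by linarith) hm
    have h9 : (‖w x‖ * ‖p x‖) ^ 2 ≤ (‖w x‖ ^ 4 + ‖p x‖ ^ 4) / 2 := by
      nlinarith [sq_nonneg (‖w x‖ ^ 2 - ‖p x‖ ^ 2)]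
    have h10 : H * S * (‖w x‖ * ‖p x‖) ≤ H * S * ((‖w x‖ ^ 2 + ‖p x‖ ^ 2) / 2) := by
      refine mul_le_mul_of_nonneg_left ?_ (mul_nonneg hH hS)
      nlinarith [sq_nonneg (‖w x‖ - ‖p x‖)]
    have h11 := mul_le_mul_of_nonneg_left h9 hq0.le
    have h12 := amgm ‖u x - lu x‖
    have h13 := amgm ‖v x - lv x‖
    linarith
  obtain ⟨hui, huI⟩ := hu.high_fourth_le hN
  obtain ⟨hvi, hvI⟩ := hv.high_fourth_le hN
  obtain ⟨hwi, hwI⟩ := hw.integral_fourth_le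
  have hw2i : Integrable (fun x => ‖w x‖ ^ 2) circleMeasure := (Lp.memLp w).integrable_norm_pow' 
  have hp2i : Integrable (fun x => ‖p x‖ ^ 2) circleMeasure :=
    Continuous.integrable_of_hasCompactSupport (by fun_prop) (HasCompactSupport.of_compactSpace _)
  have hp4i : Integrable (fun x => ‖p x‖ ^ 4) circleMeasure :=
    Continuous.integrable_of_hasCompactSupport (by fun_prop) (HasCompactSupport.of_compactSpace _)
  have a1 : Integrable (fun x => 4 * H * S * (‖w x‖ ^ 2 + ‖p x‖ ^ 2)) circleMeasure :=
    (hw2i.add hp2i).const_mul _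
  have a2 : Integrable (fun x => 2 * q⁻¹ * (‖u x - lu x‖ ^ 4 + ‖v x - lv x‖ ^ 4))
      circleMeasure := (hui.add hvi).const_mul _
  have a3 : Integrable (fun x => 2 * q * (‖w x‖ ^ 4 + ‖p x‖ ^ 4)) circleMeasure :=
    (hwi.add hp4i).const_mul _
  have a4 : Integrable (fun x => 2 * q⁻¹ * (‖u x - lu x‖ ^ 4 + ‖v x - lv x‖ ^ 4)
      + 2 * q * (‖w x‖ ^ 4 + ‖p x‖ ^ 4)) circleMeasure := a2.add a3
  refine (norm_integral_le_of_norm_le (a1.add a4) hpt).trans ?_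
  rw [integral_add' a1 a4, integral_add a2 a3,
    integral_const_mul, integral_const_mul, integral_const_mul, integral_add hw2i hp2i,
    integral_add hui hvi, integral_add hwi hp4i, integral_trigPoly_sq]
  have i1 := hw.integral_sq_le hN
  have i2 := hw.trigPoly_fourth_le N
  have sqle {e m : ℝ} (h0 : 0 ≤ e) (h : e ≤ m) : fourthConst * e ^ 2 ≤ fourthConst * m ^ 2 :=
    mul_le_mul_of_nonneg_left (pow_le_pow_left₀ h0 h 2) hD
  have j1 := hwI.trans (sqle (FiniteEnergy.energy_nonneg w) hwS')
  have j2 := i2.trans (sqle (FiniteEnergy.energy_nonneg w) hwS')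
  have j3 := huI.trans (sqle (mul_nonneg hq0.le (FiniteEnergy.energy_nonneg u))
    (mul_le_mul_of_nonneg_left huS hq0.le))
  have j4 := hvI.trans (sqle (mul_nonneg hq0.le (FiniteEnergy.energy_nonneg v))
    (mul_le_mul_of_nonneg_left hvS hq0.le))
  have j5 := i1.trans (add_le_add_right (mul_le_mul_of_nonneg_left hwS' hq0.le) _)
  calc _ ≤ 4 * H * S * ((lowMass N w + q * (4 * S)) + lowMass N w)
        + (2 * q⁻¹ * (fourthConst * (q * S) ^ 2 + fourthConst * (q * S) ^ 2)
          + 2 * q * (fourthConst * (4 * S) ^ 2 + fourthConst * (4 * S) ^ 2)) := by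
        gcongr
    _ = _ := by field_simp; ring

/-! ### Uniqueness in `H^{1/2}`. -/

theorem circleMean_eq (u : L2Circle) : circleMean u = natCoeff u 0 := by
  simp [circleMean, natCoeff, fourierCoeff]

theorem fourierCoeff_const (c : ℂ) (k : ℤ) :
    fourierCoeff (fun _ : S1 => c) k = if k = 0 then c else 0 := by
  have e : (fun _ : S1 => c) = (c • fourier 0 : C(S1, ℂ)) := by
    ext x; simp
  rw [e, ← coeffL2_contToL2, map_smul, map_smul, coeffL2_contToL2, fourierCoeff_fourier_apply,
    smul_eq_mul, mul_ite, mul_one, mul_zero]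

theorem integral_mul_star_trigPoly {g : S1 → ℂ} (hg : Integrable g circleMeasure) (c : ℕ → ℂ)
    (N : ℕ) : ∫ x, g x * star (trigPoly c N x) ∂circleMeasure
      = ∑ k ∈ Finset.range N, star (c k) * fourierCoeff g k := by
  have h (k : ℕ) : Integrable (fun x => star (c k) * (fourier (-(k : ℤ)) x • g x)) circleMeasure :=
    (hg.fourier_smul _).const_mul _
  have e : ∀ x, g x * star (trigPoly c N x)
      = ∑ k ∈ Finset.range N, star (c k) * (fourier (-(k : ℤ)) x • g x) := by
    intro x
    rw [trigPoly_apply, star_sum, Finset.mul_sum]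
    refine Finset.sum_congr rfl fun k _ => ?_
    rw [star_mul', fourier_neg, smul_eq_mul]
    simp only [Complex.star_def]
    ring
  simp only [e]
  rw [integral_finsetSum _ fun k _ => h k]
  simp only [integral_const_mul, fourierCoeff]

theorem one_add_le_two_mul_rpow (k : ℕ) :
    (1 + (k : ℝ)) ≤ 2 * (1 + (((k : ℤ) : ℝ)) ^ 2) ^ (1 / 2 : ℝ) := by
  rw [← Real.sqrt_eq_rpow, Int.cast_natCast]
  have h : (1 + (k : ℝ)) / 2 ≤ Real.sqrt (1 + (k : ℝ) ^ 2) := by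
    apply Real.le_sqrt_of_sq_le
    nlinarith [sq_nonneg ((k : ℝ) - 1)]
  linarith

theorem MemHsPlus.finiteEnergy {u : L2Circle} (hu : MemHsPlus (1 / 2) u) :
    FiniteEnergy u ∧ energy u ≤ 2 * hsNorm (1 / 2) u ^ 2 := by
  have h0 : ∀ k : ℤ, k < 0 →
      (1 + (k : ℝ) ^ 2) ^ (1 / 2 : ℝ) * ‖fourierCoeff (u : S1 → ℂ) k‖ ^ 2 = 0 := fun k hk => by
    rw [hu.2 k hk, norm_zero, zero_pow two_ne_zero, mul_zero]
  have hs : Summable fun k : ℕ => (1 + ((k : ℤ) : ℝ) ^ 2) ^ (1 / 2 : ℝ) * ‖natCoeff u k‖ ^ 2 :=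
    (summable_nat_of_neg h0).2 hu.1
  have hle (k : ℕ) : (1 + (k : ℝ)) * ‖natCoeff u k‖ ^ 2
      ≤ 2 * ((1 + ((k : ℤ) : ℝ) ^ 2) ^ (1 / 2 : ℝ) * ‖natCoeff u k‖ ^ 2) := by
    rw [← mul_assoc]
    exact mul_le_mul_of_nonneg_right (one_add_le_two_mul_rpow k) (sq_nonneg _)
  have hs' := Summable.of_nonneg_of_le (fun k => by positivity) hle (hs.mul_left 2)
  have h1 : hsNorm (1 / 2) u ^ 2
      = ∑' k : ℕ, (1 + ((k : ℤ) : ℝ) ^ 2) ^ (1 / 2 : ℝ) * ‖natCoeff u k‖ ^ 2 := by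
    rw [hsNorm, Real.sq_sqrt (tsum_nonneg fun k => by positivity)]
    exact ((hasSum_nat_of_neg h0).1 hs.hasSum).tsum_eq
  refine ⟨⟨hu.2, hs'⟩, ?_⟩
  rw [h1, ← tsum_mul_left]
  exact hs'.tsum_le_tsum hle (hs.mul_left 2)

theorem natCoeff_neg (u : L2Circle) (k : ℕ) : natCoeff (-u) k = -natCoeff u k := by
  simp only [natCoeff, ← coeffL2_apply, map_neg]

theorem FiniteEnergy.neg {u : L2Circle} (hu : FiniteEnergy u) :
    FiniteEnergy (-u) ∧ energy (-u) = energy u := by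
  have e : ∀ k, ‖natCoeff (-u) k‖ = ‖natCoeff u k‖ := fun k => by rw [natCoeff_neg, norm_neg]
  refine ⟨⟨fun k hk => ?_, ?_⟩, ?_⟩
  · rw [← coeffL2_apply, map_neg, coeffL2_apply, hu.1 k hk, neg_zero]
  · simpa only [e] using hu.2
  · simp only [energy, e]

namespace IsAlphaSzegoSolution
variable {α : ℝ} {u₀ v₀ : L2Circle} {u v : ℝ → L2Circle}

theorem finiteEnergy (hu : IsAlphaSzegoSolution α u₀ u) (t : ℝ) : FiniteEnergy (u t) :=
  (hu.mem t).finiteEnergy.1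

/-- This supplies the uniform energy bound `S` near `t₀`. Once the `H^{1/2}` distance is below 1,
the energy of the difference is at most 2, and the quasi-triangle inequality doubles it. -/
theorem eventually_energy_le (hu : IsAlphaSzegoSolution α u₀ u) (t₀ : ℝ) :
    ∀ᶠ t in 𝓝 t₀, energy (u t) ≤ 4 + 2 * energy (u t₀) := by
  filter_upwards [(hu.continuous t₀).eventually (gt_mem_nhds zero_lt_one)] with t ht
  have hs : MemHsPlus (1 / 2) (u t - u t₀) := by
    have hd := ((hu.finiteEnergy t).sub (hu.finiteEnergy t₀)).1
    refine ⟨(summable_nat_of_neg fun k hk => by rw [hd.1 k hk]; simp).1 ?_, hd.1⟩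
    refine Summable.of_nonneg_of_le (fun k => by positivity) (fun k => ?_) hd.2
    refine mul_le_mul_of_nonneg_right ?_ (sq_nonneg _)
    rw [← Real.sqrt_eq_rpow, Int.cast_natCast]
    refine Real.sqrt_le_iff.2 ⟨by positivity, ?_⟩
    nlinarith [k.cast_nonneg (α := ℝ)]
  have h1 := hs.finiteEnergy
  have h0 : 0 ≤ hsNorm (1 / 2) (u t - u t₀) := Real.sqrt_nonneg _
  have h2 : energy (u t - u t₀) ≤ 2 := by nlinarith [h1.2]
  have h3 := (hu.finiteEnergy t₀).neg
  have h4 := (h1.1.sub h3.1).2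
  rw [sub_neg_eq_add, sub_add_cancel, h3.2] at h4
  linarith

theorem hasDerivAt_natCoeff (hu : IsAlphaSzegoSolution α u₀ u) (t : ℝ) (k : ℕ) :
    HasDerivAt (fun τ => natCoeff (u τ) k) (-Complex.I * (fourierCoeff (cubic (u t)) k
      + (α : ℂ) * if k = 0 then natCoeff (u t) 0 else 0)) t := by
  obtain ⟨d, hd, he⟩ := hu.equation t k
  rw [szegoProj, if_pos (Int.natCast_nonneg k), fourierCoeff_const, circleMean_eq] at he
  simp only [Int.natCast_eq_zero] at he
  rw [← he, ← mul_assoc, neg_mul, Complex.I_mul_I, neg_neg, one_mul]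
  exact hd

/-- A differential inequality for the low frequency mass of the difference of two solutions. -/
theorem exists_deriv_lowMass_sub (hu : IsAlphaSzegoSolution α u₀ u)
    (hv : IsAlphaSzegoSolution α v₀ v) {S : ℝ} (hS : 0 ≤ S) {t : ℝ} (huS : energy (u t) ≤ S)
    (hvS : energy (v t) ≤ S) {N : ℕ} (hN : 0 < N) :
    ∃ d, HasDerivAt (fun τ => lowMass N (u τ - v τ)) d t ∧
      |d| ≤ (16 * S + 32 * S ^ 2 + 136 * fourthConst * S ^ 2 + 2 * |α| + 1) * harmonicSum N
        * (lowMass N (u t - v t) + (N : ℝ) ^ (-(1 / 4) : ℝ)) := by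
  set w := u t - v t with hw
  set G : ℕ → ℂ := fun k => fourierCoeff (cubic (u t)) k - fourierCoeff (cubic (v t)) k with hG
  have hd (k : ℕ) : HasDerivAt (fun τ => natCoeff (u τ - v τ) k)
      (-Complex.I * (G k + (α : ℂ) * if k = 0 then natCoeff w 0 else 0)) t := by
    simp only [natCoeff_sub]
    refine ((hu.hasDerivAt_natCoeff t k).sub (hv.hasDerivAt_natCoeff t k)).congr_deriv ?_
    rw [hG, hw, natCoeff_sub]
    split_ifs <;> ring
  refine ⟨_, HasDerivAt.fun_sum fun k _ => (hd k).norm_sq, ?_⟩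
  -- The `α` contribution is a real multiple of `-Complex.I * natCoeff w 0`, orthogonal over ℝ to
  -- `natCoeff w 0`, so it disappears.
  have hin (k : ℕ) : 2 * inner ℝ (natCoeff w k)
      (-Complex.I * (G k + (α : ℂ) * if k = 0 then natCoeff w 0 else 0))
      = 2 * ((star (natCoeff w k) * G k).im) := by
    rw [Complex.inner]
    split_ifs with h
    · subst h
      simp
      ring
    · simp
      ring
  have hsum : ∑ k ∈ Finset.range N, 2 * inner ℝ (natCoeff w k)
      (-Complex.I * (G k + (α : ℂ) * if k = 0 then natCoeff w 0 else 0))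
      = 2 * (∫ x, (cubic (u t) x - cubic (v t) x) * star (trigPoly (natCoeff w) N x)
        ∂circleMeasure).im := by
    have hui := (hu.finiteEnergy t).integrable_cubic
    have hvi := (hv.finiteEnergy t).integrable_cubic
    have hsub (k : ℤ) : fourierCoeff (fun x => cubic (u t) x - cubic (v t) x) k
        = fourierCoeff (cubic (u t)) k - fourierCoeff (cubic (v t)) k := by
      simp only [fourierCoeff, smul_sub]
      exact integral_sub (hui.fourier_smul _) (hvi.fourier_smul _)
    rw [integral_mul_star_trigPoly (g := fun x => cubic (u t) x - cubic (v t) x) (hui.sub hvi),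
      Complex.im_sum, Finset.mul_sum]
    refine Finset.sum_congr rfl fun k _ => ?_
    rw [hin, hsub]
  rw [hsum]
  have hI := norm_integral_cubic_sub_le (hu.finiteEnergy t) (hv.finiteEnergy t) hS huS hvS hN
  have hH := one_le_harmonicSum hN
  have hD := fourthConst_nonneg
  have hy := lowMass_nonneg N w
  have hq : 0 ≤ (N : ℝ) ^ (-(1 / 4) : ℝ) := by positivity
  have h1 := (Complex.abs_im_le_norm _).trans hI
  rw [abs_mul, abs_two]
  set q := (N : ℝ) ^ (-(1 / 4) : ℝ)
  set H := harmonicSum N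
  have h2 : 68 * fourthConst * S ^ 2 ≤ 68 * fourthConst * S ^ 2 * H :=
    le_mul_of_one_le_right (by positivity) hH
  have h3 := mul_le_mul_of_nonneg_right h2 hq
  have h4 : 0 ≤ (32 * S ^ 2 + 136 * fourthConst * S ^ 2 + 2 * |α| + 1) * H * lowMass N w := by
    positivity
  have h5 : 0 ≤ (16 * S + 2 * |α| + 1) * H * q := by positivity
  nlinarith
end IsAlphaSzegoSolution

/-- Grönwall in both time directions: the sign `σ` reflects time when `t < t₀`. -/
theorem abs_le_of_abs_deriv_le {y : ℝ → ℝ} {t₀ δ K ε : ℝ} (hK : 0 < K)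
    (h : ∀ t, |t - t₀| < δ → ∃ d, HasDerivAt y d t ∧ |d| ≤ K * |y t| + ε) (h0 : y t₀ = 0)
    {t : ℝ} (ht : |t - t₀| < δ) : |y t| ≤ ε / K * (Real.exp (K * |t - t₀|) - 1) := by
  obtain ⟨σ, hσ, hσt⟩ : ∃ σ : ℝ, |σ| = 1 ∧ t₀ + σ * |t - t₀| = t := by
    rcases le_total 0 (t - t₀) with hs | hs
    · exact ⟨1, by simp, by rw [abs_of_nonneg hs]; ring⟩
    · exact ⟨-1, by simp, by rw [abs_of_nonpos hs]; ring⟩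
  set b := |t - t₀| with hb
  have hd : ∀ s ∈ Set.Icc 0 b, HasDerivAt (fun s => y (t₀ + σ * s))
      (deriv y (t₀ + σ * s) * σ) s ∧
      ‖deriv y (t₀ + σ * s) * σ‖ ≤ K * ‖y (t₀ + σ * s)‖ + ε := by
    intro s hs
    have hlt : |t₀ + σ * s - t₀| < δ := by
      rw [add_sub_cancel_left, abs_mul, hσ, one_mul, abs_of_nonneg hs.1]
      exact hs.2.trans_lt ht
    obtain ⟨d, hd, hdle⟩ := h _ hlt
    have hin : HasDerivAt (fun s => t₀ + σ * s) σ s := by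
      simpa using ((hasDerivAt_id s).const_mul σ).const_add t₀
    rw [hd.deriv, norm_mul, Real.norm_eq_abs σ, hσ, mul_one]
    exact ⟨hd.comp s hin, hdle⟩
  have hg := norm_le_gronwallBound_of_norm_deriv_right_le (δ := 0) (K := K) (ε := ε)
    (f := fun s => y (t₀ + σ * s)) (a := 0) (b := b)
    (fun s hs => (hd s hs).1.continuousAt.continuousWithinAt)
    (fun s hs => (hd s (Set.Ico_subset_Icc_self hs)).1.hasDerivWithinAt) (by simp [h0])
    (fun s hs => (hd s (Set.Ico_subset_Icc_self hs)).2) b ⟨abs_nonneg _, le_rfl⟩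
  rw [gronwallBound_of_K_ne_0 hK.ne'] at hg
  simpa only [zero_mul, zero_add, sub_zero, hσt, Real.norm_eq_abs] using hg

namespace IsAlphaSzegoSolution
variable {α : ℝ} {u₀ v₀ : L2Circle} {u v : ℝ → L2Circle}

/-- Two solutions that agree at some time agree near that time. -/
theorem eventually_eq (hu : IsAlphaSzegoSolution α u₀ u) (hv : IsAlphaSzegoSolution α v₀ v)
    {t₀ : ℝ} (h : u t₀ = v t₀) : ∀ᶠ t in 𝓝 t₀, u t = v t := by
  set S := 4 + 2 * energy (u t₀) with hSdef
  have hS : 0 ≤ S := by linarith [FiniteEnergy.energy_nonneg (u t₀)]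
  have hv' := hv.eventually_energy_le t₀
  rw [← h] at hv'
  obtain ⟨δ, hδ, hball⟩ := Metric.eventually_nhds_iff.1 ((hu.eventually_energy_le t₀).and hv')
  set A := 16 * S + 32 * S ^ 2 + 136 * fourthConst * S ^ 2 + 2 * |α| + 1 with hA
  have hA0 : 0 < A := by have := fourthConst_nonneg; positivity
  -- With `A * |t - t₀| ≤ 1/8` the Grönwall factor is at most `exp ((1 + log N) / 8)`. This loses `N
  -- ^ (1/8)` against the gain `N ^ (-1/4)`, and the step length does not depend on `N`.
  refine Metric.eventually_nhds_iff.2 ⟨min δ (1 / (8 * A)), by positivity, fun t ht => ?_⟩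
  rw [Real.dist_eq, lt_min_iff] at ht
  have hAt : A * |t - t₀| ≤ 1 / 8 := by
    have := mul_le_mul_of_nonneg_left ht.2.le hA0.le
    rwa [show A * (1 / (8 * A)) = 1 / 8 by field_simp] at this
  have hz (k : ℕ) : natCoeff (u t₀ - v t₀) k = 0 := by rw [natCoeff_sub, h, sub_self]
  have hy (N : ℕ) (hN : 0 < N) :
      lowMass N (u t - v t) ≤ Real.exp (1 / 8) * (N : ℝ) ^ (-(1 / 8) : ℝ) := by
    have hN' : (0 : ℝ) < N := by exact_mod_cast hN
    have hH := one_le_harmonicSum hN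
    have hb := abs_le_of_abs_deriv_le (y := fun τ => lowMass N (u τ - v τ)) (t₀ := t₀) (δ := δ)
      (K := A * harmonicSum N) (ε := A * harmonicSum N * (N : ℝ) ^ (-(1 / 4) : ℝ))
      (by positivity) (fun τ hτ => by
        obtain ⟨h1, h2⟩ := hball (show dist τ t₀ < δ by rwa [Real.dist_eq])
        obtain ⟨d, hd, hdle⟩ := exists_deriv_lowMass_sub hu hv hS h1 h2 hN
        refine ⟨d, hd, hdle.trans (le_of_eq ?_)⟩
        rw [abs_of_nonneg (lowMass_nonneg _ _), mul_add])
      (by simp only [lowMass, hz]; simp) ht.1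
    refine (le_abs_self _).trans (hb.trans ?_)
    rw [mul_div_cancel_left₀ _ (by positivity)]
    have h1 : Real.exp (A * harmonicSum N * |t - t₀|) ≤ Real.exp (1 / 8) * (N : ℝ) ^ (1 / 8 : ℝ) := by
      rw [Real.rpow_def_of_pos hN', ← Real.exp_add]
      apply Real.exp_le_exp.2
      have h2 := mul_le_mul_of_nonneg_right hAt (harmonicSum_nonneg N)
      have h3 := harmonicSum_le N
      linarith
    calc (N : ℝ) ^ (-(1 / 4) : ℝ) * (Real.exp (A * harmonicSum N * |t - t₀|) - 1)
        ≤ (N : ℝ) ^ (-(1 / 4) : ℝ) * (Real.exp (1 / 8) * (N : ℝ) ^ (1 / 8 : ℝ)) := by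
          gcongr
          linarith
      _ = Real.exp (1 / 8) * (N : ℝ) ^ (-(1 / 8) : ℝ) := by
          rw [mul_left_comm, ← Real.rpow_add hN']
          norm_num
  have hlim : Tendsto (fun N : ℕ => Real.exp (1 / 8) * (N : ℝ) ^ (-(1 / 8) : ℝ)) atTop (𝓝 0) := by
    have := ((tendsto_rpow_neg_atTop (show (0 : ℝ) < 1 / 8 by norm_num)).comp
      tendsto_natCast_atTop_atTop).const_mul (Real.exp (1 / 8))
    simpa using this
  refine (hu.finiteEnergy t).1.ext (hv.finiteEnergy t).1 fun k => ?_
  have hk : ‖natCoeff (u t - v t) k‖ ^ 2 ≤ 0 := by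
    refine ge_of_tendsto hlim ?_
    filter_upwards [eventually_gt_atTop k] with N hN
    refine le_trans ?_ (hy N (by omega))
    exact Finset.single_le_sum (f := fun k => ‖natCoeff (u t - v t) k‖ ^ 2)
      (fun _ _ => by positivity) (Finset.mem_range.2 hN)
  have : natCoeff (u t - v t) k = 0 := by
    rw [← norm_eq_zero]
    exact pow_eq_zero_iff two_ne_zero |>.1 (hk.antisymm (sq_nonneg _))
  rwa [natCoeff_sub, sub_eq_zero] at this

/-- The set of times of agreement is closed because coefficients are continuous, open by
`eventually_eq`, and contains `0`; the line is connected. -/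
theorem unique (hu : IsAlphaSzegoSolution α u₀ u) (hv : IsAlphaSzegoSolution α u₀ v) : u = v := by
  have hcl : IsClosed {t | u t = v t} := by
    have e : {t | u t = v t} = ⋂ k, {t | natCoeff (u t) k = natCoeff (v t) k} := by
      ext t
      simp only [Set.mem_ofPred_eq, Set.mem_iInter]
      exact ⟨fun h k => by rw [h], (hu.finiteEnergy t).1.ext (hv.finiteEnergy t).1⟩
    rw [e]
    refine isClosed_iInter fun k => isClosed_eq ?_ ?_
    · exact continuous_iff_continuousAt.2 fun t => (hu.hasDerivAt_natCoeff t k).continuousAt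
    · exact continuous_iff_continuousAt.2 fun t => (hv.hasDerivAt_natCoeff t k).continuousAt
  have hop : IsOpen {t | u t = v t} := isOpen_iff_mem_nhds.2 fun t ht => hu.eventually_eq hv ht
  have huniv := IsClopen.eq_univ ⟨hcl, hop⟩ ⟨0, by
    rw [Set.mem_ofPred_eq, hu.initial, hv.initial]⟩
  funext t
  exact (huniv ▸ Set.mem_univ t : t ∈ {t | u t = v t})

end IsAlphaSzegoSolution

/-! ### From ℓ¹ solutions to solutions in `H^{1/2}`. -/

/-- The function on the circle with given summable Fourier coefficients. -/
noncomputable def ell1Fun : Ell1 →L[ℂ] C(S1, ℂ) :=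
  ell1Lift (fun k => fourier (k : ℤ)) fun k => (fourier_norm (k : ℤ)).le

/-- The function on the circle with given summable Fourier coefficients at `-k`. -/
noncomputable def ell1CoFun : Ell1 →L[ℂ] C(S1, ℂ) :=
  ell1Lift (fun k => fourier (-(k : ℤ))) fun k => (fourier_norm (-(k : ℤ))).le

theorem ell1Fun_basis (k : ℕ) : ell1Fun (ell1Basis k) = fourier (k : ℤ) := ell1Lift_basis _ _

theorem ell1CoFun_basis (k : ℕ) : ell1CoFun (ell1Basis k) = fourier (-(k : ℤ)) :=
  ell1Lift_basis _ _

theorem star_ell1Fun (u : Ell1) : star (ell1Fun u) = ell1CoFun (star u) := by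
  have : (fun v => ell1CoFun v) = fun v => star (ell1Fun (star v)) := by
    refine ell1_ext ⟨fun _ _ => map_add _ _ _, fun _ _ => map_smul _ _ _⟩
      ⟨fun x y => by simp, fun c x => by rw [star_smul, map_smul, star_smul, star_star]⟩
      (by fun_prop) ?_ fun k => ?_
    · exact continuous_star.comp (ell1Fun.continuous.comp continuous_star)
    · rw [star_ell1Basis, ell1Fun_basis, ell1CoFun_basis]
      ext x
      rw [fourier_neg]
      rfl
  have h := congrFun this (star u)
  simp only [star_star] at h
  exact h.symm

theorem coeff_ell1Fun_neg (u : Ell1) {k : ℤ} (hk : k < 0) :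
    coeffL2 k (contToL2 (ell1Fun u)) = 0 := by
  revert u
  refine congrFun (ell1_ext (g := fun _ => (0 : ℂ)) ⟨by simp, by simp⟩ ⟨by simp, by simp⟩
    (by fun_prop) (by fun_prop) fun j => ?_)
  rw [ell1Fun_basis, coeffL2_contToL2, fourierCoeff_fourier_apply, if_neg (by omega)]

theorem coeff_ell1Fun (u : Ell1) (k : ℕ) : coeffL2 k (contToL2 (ell1Fun u)) = u k := by
  revert u
  refine congrFun (ell1_ext ⟨by simp, by simp⟩ ⟨by simp, by simp⟩
    (by fun_prop) (continuous_apply_ell1 k) fun j => ?_)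
  rw [ell1Fun_basis, coeffL2_contToL2, fourierCoeff_fourier_apply, ell1Basis_apply]
  simp

theorem coeff_trilin (a b v : Ell1) (k : ℕ) :
    coeffL2 k (contToL2 (ell1Fun a * ell1Fun b * ell1CoFun v)) = trilin a b v k := by
  revert v
  refine congrFun (ell1_ext ⟨by simp [mul_add], by simp⟩ ⟨by simp, by simp⟩ (by fun_prop)
    ((continuous_apply_ell1 k).comp (by fun_prop)) fun c => ?_)
  revert b
  refine congrFun (ell1_ext ⟨by simp [mul_add, add_mul], by simp⟩ ⟨by simp, by simp⟩
    (by fun_prop) ((continuous_apply_ell1 k).comp (by fun_prop)) fun b => ?_)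
  revert a
  refine congrFun (ell1_ext ⟨by simp [add_mul], by simp⟩ ⟨by simp, by simp⟩
    (by fun_prop) ((continuous_apply_ell1 k).comp (by fun_prop)) fun a => ?_)
  have e : ell1Fun (ell1Basis a) * ell1Fun (ell1Basis b) * ell1CoFun (ell1Basis c)
      = fourier ((a : ℤ) + b + -c) := by
    rw [ell1Fun_basis, ell1Fun_basis, ell1CoFun_basis]
    ext x
    simp only [ContinuousMap.mul_apply, fourier_add]
  rw [e, coeffL2_contToL2, fourierCoeff_fourier_apply, trilin_basis,
    apply_ite (fun w : Ell1 => w k), ell1Basis_apply]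
  split_ifs <;> first | omega | rfl

/-- The square integrable function with given summable Fourier coefficients. -/
noncomputable def ell1ToL2 (u : Ell1) : L2Circle := contToL2 (ell1Fun u)

theorem natCoeff_ell1ToL2 (u : Ell1) (k : ℕ) : natCoeff (ell1ToL2 u) k = u k := by
  rw [natCoeff, ← coeffL2_apply]
  exact coeff_ell1Fun u k

theorem nonnegFreq_ell1ToL2 (u : Ell1) : NonnegFreq (ell1ToL2 u) := fun k hk => by
  rw [← coeffL2_apply]
  exact coeff_ell1Fun_neg u hk

theorem fourierCoeff_cubic_ell1ToL2 (u : Ell1) (k : ℕ) :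
    fourierCoeff (cubic (ell1ToL2 u)) k = trilin u u (star u) k := by
  rw [← coeff_trilin, coeffL2_contToL2]
  refine congrFun (fourierCoeff_congr_ae ?_) _
  filter_upwards [ContinuousMap.coeFn_toLp (p := 2) (𝕜 := ℂ) circleMeasure (ell1Fun u)] with x hx
  rw [cubic, ell1ToL2, hx, ← star_ell1Fun, ContinuousMap.mul_apply, ContinuousMap.mul_apply,
    ContinuousMap.star_apply, Complex.star_def, mul_assoc, Complex.mul_conj,
    Complex.normSq_eq_norm_sq, mul_comm]

theorem MemHsPlus.of_finiteEnergy {u : L2Circle} (hu : FiniteEnergy u) :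
    MemHsPlus (1 / 2) u ∧ hsNorm (1 / 2) u ≤ Real.sqrt (energy u) := by
  have h0 : ∀ k : ℤ, k < 0 →
      (1 + (k : ℝ) ^ 2) ^ (1 / 2 : ℝ) * ‖fourierCoeff (u : S1 → ℂ) k‖ ^ 2 = 0 := fun k hk => by
    rw [hu.1 k hk, norm_zero, zero_pow two_ne_zero, mul_zero]
  have hle (k : ℕ) : (1 + ((k : ℤ) : ℝ) ^ 2) ^ (1 / 2 : ℝ) * ‖natCoeff u k‖ ^ 2
      ≤ (1 + (k : ℝ)) * ‖natCoeff u k‖ ^ 2 := by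
    refine mul_le_mul_of_nonneg_right ?_ (sq_nonneg _)
    rw [← Real.sqrt_eq_rpow, Int.cast_natCast]
    refine Real.sqrt_le_iff.2 ⟨by positivity, ?_⟩
    nlinarith [k.cast_nonneg (α := ℝ)]
  have hs := Summable.of_nonneg_of_le (fun k => by positivity) hle hu.2
  refine ⟨⟨(summable_nat_of_neg h0).1 hs, hu.1⟩, Real.sqrt_le_sqrt ?_⟩
  rw [((hasSum_nat_of_neg h0).1 hs.hasSum).tsum_eq]
  exact hs.tsum_le_tsum hle hu.2

theorem finiteEnergy_ell1ToL2 (u : Ell1) (hm : momentum u ≠ ⊤) :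
    FiniteEnergy (ell1ToL2 u) ∧
      energy (ell1ToL2 u) = ‖ell1ToEll2 u‖ ^ 2 + (momentum u).toReal := by
  have h1 : HasSum (fun k => ‖u k‖ ^ 2) (‖ell1ToEll2 u‖ ^ 2) := by
    simpa only [ell1ToEll2_apply] using (ell1ToEll2 u).hasSum_norm_sq
  have e : (fun k : ℕ => (k : ENNReal) * ‖u k‖ₑ ^ 2)
      = fun k : ℕ => ENNReal.ofReal (k * ‖u k‖ ^ 2) := by
    funext k
    rw [ENNReal.ofReal_mul k.cast_nonneg, ENNReal.ofReal_natCast,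
      ENNReal.ofReal_pow (norm_nonneg _), ofReal_norm]
  have h2 : HasSum (fun k : ℕ => (k : ℝ) * ‖u k‖ ^ 2) (momentum u).toReal := by
    rw [momentum, e] at hm ⊢
    have := ENNReal.hasSum_toReal hm
    rw [← ENNReal.tsum_toReal_eq fun _ => ENNReal.ofReal_ne_top] at this
    simpa only [ENNReal.toReal_ofReal (mul_nonneg (Nat.cast_nonneg _) (sq_nonneg _))] using this
  have h3 : HasSum (fun k : ℕ => (1 + (k : ℝ)) * ‖natCoeff (ell1ToL2 u) k‖ ^ 2)
      (‖ell1ToEll2 u‖ ^ 2 + (momentum u).toReal) := by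
    simpa only [natCoeff_ell1ToL2, add_mul, one_mul] using h1.add h2
  exact ⟨⟨nonnegFreq_ell1ToL2 u, h3.summable⟩, h3.tsum_eq⟩

/-- Coefficientwise continuity and conservation of the energy imply strong continuity. -/
theorem tendsto_energy_sub {u : ℝ → L2Circle} (hu : ∀ t, FiniteEnergy (u t)) {e : ℝ}
    (he : ∀ t, energy (u t) = e) (hc : ∀ k, Continuous fun t => natCoeff (u t) k) (t₀ : ℝ) :
    Tendsto (fun t => energy (u t - u t₀)) (𝓝 t₀) (𝓝 0) := by
  set P : ℕ → L2Circle → ℝ := fun N w => ∑ k ∈ Finset.range N, (1 + (k : ℝ)) * ‖natCoeff w k‖ ^ 2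
    with hP
  -- The tail of the difference is bounded by the two tails, each being the common energy `e` minus
  -- a finite sum. Everything on the right is continuous in `t`, and at `t₀` it equals `4 * (e - P N
  -- (u t₀))`, which is small for large `N`.
  have htail (N : ℕ) (t : ℝ) : energy (u t - u t₀)
      ≤ P N (u t - u t₀) + (2 * (e - P N (u t)) + 2 * (e - P N (u t₀))) := by
    have hd := ((hu t).sub (hu t₀)).1
    have split {w : L2Circle} (hw : FiniteEnergy w) :
        HasSum (fun k : ℕ => (1 + ((k + N : ℕ) : ℝ)) * ‖natCoeff w (k + N)‖ ^ 2)
          (energy w - P N w) :=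
      (hasSum_nat_add_iff' N).2 hw.2.hasSum
    have hle := hasSum_le (fun k => ?_) (split hd)
      (((split (hu t)).mul_left 2).add ((split (hu t₀)).mul_left 2))
    · rw [he, he] at hle
      linarith
    · have h1 : ‖natCoeff (u t - u t₀) (k + N)‖ ^ 2
          ≤ 2 * ‖natCoeff (u t) (k + N)‖ ^ 2 + 2 * ‖natCoeff (u t₀) (k + N)‖ ^ 2 := by
        rw [natCoeff_sub]
        have := norm_sub_le (natCoeff (u t) (k + N)) (natCoeff (u t₀) (k + N))
        nlinarith [norm_nonneg (natCoeff (u t) (k + N) - natCoeff (u t₀) (k + N)),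
          sq_nonneg (‖natCoeff (u t) (k + N)‖ - ‖natCoeff (u t₀) (k + N)‖)]
      nlinarith [(k + N).cast_nonneg (α := ℝ)]
  have hPc (N : ℕ) : Continuous fun t =>
      P N (u t - u t₀) + (2 * (e - P N (u t)) + 2 * (e - P N (u t₀))) := by
    simp only [hP, natCoeff_sub]
    fun_prop
  have hP0 (N : ℕ) : P N (u t₀ - u t₀) = 0 :=
    Finset.sum_eq_zero fun k _ => by rw [natCoeff_sub, sub_self, norm_zero]; simp
  have hlim : Tendsto (fun N => 4 * (e - P N (u t₀))) atTop (𝓝 0) := by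
    have h1 : Tendsto (fun N => P N (u t₀)) atTop (𝓝 e) := by
      rw [← he t₀]
      exact (hu t₀).2.hasSum.tendsto_sum_nat
    simpa using (h1.const_sub e).const_mul 4
  refine tendsto_order.2 ⟨fun a ha => Eventually.of_forall fun t =>
    ha.trans_le (FiniteEnergy.energy_nonneg _), fun a ha => ?_⟩
  obtain ⟨N, hN⟩ := (hlim.eventually (gt_mem_nhds ha)).exists
  have h2 := (hPc N).continuousAt.eventually (gt_mem_nhds (show
    P N (u t₀ - u t₀) + (2 * (e - P N (u t₀)) + 2 * (e - P N (u t₀))) < a by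
      rw [hP0]; linarith))
  filter_upwards [h2] with t ht
  exact (htail N t).trans_lt ht

/-- Differentiability in ℓ¹ yields the equation and the continuity of each coefficient. It says
nothing about the weighted norm; continuity in `H^{1/2}` comes from conservation of mass plus
momentum, which is `energy`. -/
theorem isAlphaSzegoSolution_ell1ToL2 {α : ℝ} {U : ℝ → Ell1}
    (hU : ∀ t, HasDerivAt U (szegoField α (U t)) t)
    (hL2 : ∀ t, ‖ell1ToEll2 (U t)‖ = ‖ell1ToEll2 (U 0)‖)
    (hmom : ∀ t, momentum (U t) = momentum (U 0)) (hm : momentum (U 0) ≠ ⊤) :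
    IsAlphaSzegoSolution α (ell1ToL2 (U 0)) fun t => ell1ToL2 (U t) := by
  have hE (t : ℝ) := finiteEnergy_ell1ToL2 (U t) (by rw [hmom]; exact hm)
  have hder (t : ℝ) (k : ℕ) : HasDerivAt (fun τ => natCoeff (ell1ToL2 (U τ)) k)
      (szegoField α (U t) k) t := by
    simp only [natCoeff_ell1ToL2]
    exact ((lp.evalCLM ℂ (fun _ : ℕ => ℂ) 1 k).restrictScalars ℝ).hasFDerivAt.comp_hasDerivAt t
      (hU t)
  refine ⟨fun t => (MemHsPlus.of_finiteEnergy (hE t).1).1, fun t₀ => ?_, rfl, fun t k => ?_⟩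
  · have h := tendsto_energy_sub (fun t => (hE t).1) (e := energy (ell1ToL2 (U 0)))
      (fun t => by rw [(hE t).2, (hE 0).2, hL2, hmom])
      (fun k => continuous_iff_continuousAt.2 fun t => (hder t k).continuousAt) t₀
    have h' : Tendsto (fun t => Real.sqrt (energy (ell1ToL2 (U t) - ell1ToL2 (U t₀)))) (𝓝 t₀)
        (𝓝 0) := by simpa using h.sqrt
    exact squeeze_zero (fun t => Real.sqrt_nonneg _)
      (fun t => (MemHsPlus.of_finiteEnergy ((hE t).1.sub (hE t₀).1).1).2) h'
  · rw [fourierCoeff_const, circleMean_eq, natCoeff_ell1ToL2]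
    rcases lt_or_ge k 0 with hk | hk
    · refine ⟨0, ?_, ?_⟩
      · simp only [nonnegFreq_ell1ToL2 _ k hk]
        exact hasDerivAt_const _ _
      · rw [szegoProj, if_neg (by omega), if_neg (by omega)]
        simp
    · lift k to ℕ using hk
      refine ⟨_, hder t k, ?_⟩
      rw [szegoProj, if_pos (Int.natCast_nonneg k), fourierCoeff_cubic_ell1ToL2]
      simp only [szegoField, lp.coeFn_smul, lp.coeFn_add, Pi.smul_apply, Pi.add_apply,
        smul_eq_mul, ell1Basis_apply, Int.natCast_eq_zero]
      rw [← mul_assoc, mul_neg, Complex.I_mul_I, neg_neg, one_mul]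
      split_ifs <;> simp

/-! ### Sobolev control of the initial data, and the conclusion. -/

theorem hsNorm_nonneg (s : ℝ) (u : L2Circle) : 0 ≤ hsNorm s u := Real.sqrt_nonneg _

theorem sq_rpow_le {s : ℝ} (hs : 0 ≤ s) {n k : ℕ} (h : n ≤ k) :
    ((n : ℝ) ^ s) ^ 2 ≤ (1 + (k : ℝ) ^ 2) ^ s := by
  rw [← Real.rpow_natCast, ← Real.rpow_mul n.cast_nonneg, mul_comm, Real.rpow_mul n.cast_nonneg,
    Real.rpow_natCast]
  refine Real.rpow_le_rpow (sq_nonneg _) ?_ hs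
  have : (n : ℝ) ≤ k := by exact_mod_cast h
  nlinarith [n.cast_nonneg (α := ℝ)]

namespace MemHsPlus
variable {s : ℝ} {u : L2Circle}

theorem hasSum_nat (hu : MemHsPlus s u) :
    HasSum (fun k : ℕ => (1 + (k : ℝ) ^ 2) ^ s * ‖natCoeff u k‖ ^ 2) (hsNorm s u ^ 2) := by
  have h0 : ∀ k : ℤ, k < 0 →
      (1 + (k : ℝ) ^ 2) ^ s * ‖fourierCoeff (u : S1 → ℂ) k‖ ^ 2 = 0 := fun k hk => by
    rw [hu.2 k hk, norm_zero, zero_pow two_ne_zero, mul_zero]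
  rw [hsNorm, Real.sq_sqrt (tsum_nonneg fun k => by positivity)]
  simpa only [Int.cast_natCast, natCoeff] using (hasSum_nat_of_neg h0).2 hu.1.hasSum

theorem norm_natCoeff_le (hs : 0 ≤ s) (hu : MemHsPlus s u) (k : ℕ) :
    (k : ℝ) ^ s * ‖natCoeff u k‖ ≤ hsNorm s u := by
  refine le_of_sq_le_sq ?_ (hsNorm_nonneg s u)
  rw [mul_pow]
  exact (mul_le_mul_of_nonneg_right (sq_rpow_le hs le_rfl) (sq_nonneg _)).trans
    (le_hasSum hu.hasSum_nat k fun j _ => by positivity)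

theorem summable_natCoeff (hs : 1 < s) (hu : MemHsPlus s u) :
    Summable fun k => ‖natCoeff u k‖ := by
  refine summable_of_isBigO_nat (Real.summable_nat_rpow.2 (show -s < -1 by linarith))
    (Asymptotics.IsBigO.of_bound (hsNorm s u) ?_)
  filter_upwards [eventually_gt_atTop 0] with k hk
  have hk' : (0 : ℝ) < (k : ℝ) ^ s := Real.rpow_pos_of_pos (by exact_mod_cast hk) s
  rw [norm_norm, Real.norm_of_nonneg (by positivity), Real.rpow_neg k.cast_nonneg,
    ← div_eq_mul_inv, le_div_iff₀ hk', mul_comm]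
  exact norm_natCoeff_le (by linarith) hu k

theorem exists_ell1 (hs : 1 < s) (hu : MemHsPlus s u) : ∃ a : Ell1, ell1ToL2 a = u := by
  have hm : Memℓp (natCoeff u) 1 := memℓp_gen (by simpa using summable_natCoeff hs hu)
  refine ⟨⟨natCoeff u, hm⟩, (nonnegFreq_ell1ToL2 _).ext hu.2 fun k => ?_⟩
  rw [natCoeff_ell1ToL2]

theorem norm_ell1ToEll2_le (hs : 0 ≤ s) {a : Ell1} (ha : MemHsPlus s (ell1ToL2 a)) :
    ‖ell1ToEll2 a‖ ≤ hsNorm s (ell1ToL2 a) := by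
  refine le_of_sq_le_sq (hasSum_le (fun k => ?_) (ell1ToEll2 a).hasSum_norm_sq ha.hasSum_nat)
    (hsNorm_nonneg _ _)
  rw [ell1ToEll2_apply, natCoeff_ell1ToL2]
  exact le_mul_of_one_le_left (sq_nonneg _)
    (Real.one_le_rpow (by linarith [sq_nonneg (k : ℝ)]) hs)

/-- Column `n` contains only coefficients of index at least `n + 1`, where the Sobolev weight is at
least `(n + 1) ^ (2 * s)`. -/
theorem norm_hankelOp_basis_le (hs : 0 ≤ s) {a : Ell1} (ha : MemHsPlus s (ell1ToL2 a)) (n : ℕ) :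
    ‖hankelOp a (ell2Basis n)‖ ≤ ((n + 1 : ℕ) : ℝ) ^ (-s) * hsNorm s (ell1ToL2 a) := by
  have hn : (0 : ℝ) < ((n + 1 : ℕ) : ℝ) ^ s := Real.rpow_pos_of_pos (by positivity) s
  rw [Real.rpow_neg (Nat.cast_nonneg _), inv_mul_eq_div, le_div_iff₀ hn]
  refine le_of_sq_le_sq ?_ (hsNorm_nonneg _ _)
  rw [mul_pow]
  refine hasSum_le_inj (fun l => l + n + 1) (fun _ _ h => by simpa using h)
    (fun k _ => by positivity) (fun l => ?_)
    ((hankelOp a (ell2Basis n)).hasSum_norm_sq.mul_right _) ha.hasSum_nat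
  rw [hankelOp_basis_apply, natCoeff_ell1ToL2, mul_comm]
  exact mul_le_mul_of_nonneg_right (sq_rpow_le hs (by omega)) (sq_nonneg _)

theorem momentum_ne_top (hs : 1 ≤ s) {a : Ell1} (ha : MemHsPlus s (ell1ToL2 a)) :
    momentum a ≠ ⊤ := by
  refine ne_top_of_le_ne_top ha.hasSum_nat.summable.tsum_ofReal_ne_top
    (ENNReal.tsum_le_tsum fun k => ?_)
  rw [← ofReal_norm, ← ENNReal.ofReal_pow (norm_nonneg _), ← ENNReal.ofReal_natCast,
    ← ENNReal.ofReal_mul k.cast_nonneg, natCoeff_ell1ToL2]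
  refine ENNReal.ofReal_le_ofReal (mul_le_mul_of_nonneg_right ?_ (sq_nonneg _))
  have h1 : (1 : ℝ) ≤ 1 + (k : ℝ) ^ 2 := by linarith [sq_nonneg (k : ℝ)]
  have h2 := Real.rpow_le_rpow_of_exponent_le h1 hs
  rw [Real.rpow_one] at h2
  nlinarith [sq_nonneg ((k : ℝ) - 1)]

/-- A bound for the trace norm of the shifted Hankel operator by a Sobolev norm. -/
theorem hankel_bound (hs : 1 < s) {a : Ell1} (ha : MemHsPlus s (ell1ToL2 a)) :
    ‖ell1ToEll2 a‖ₑ + 2 * ∑' n, ‖hankelOp a (ell2Basis n)‖ₑ ≤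
      ENNReal.ofReal ((1 + 2 * ∑' n : ℕ, ((n + 1 : ℕ) : ℝ) ^ (-s)) * hsNorm s (ell1ToL2 a)) := by
  have hs0 : 0 ≤ s := by linarith
  have hζ : Summable fun n : ℕ => ((n + 1 : ℕ) : ℝ) ^ (-s) :=
    (summable_nat_add_iff 1).2 (Real.summable_nat_rpow.2 (show -s < -1 by linarith))
  have hζ' := hζ.mul_right (hsNorm s (ell1ToL2 a))
  have hH := hsNorm_nonneg s (ell1ToL2 a)
  have hpos (n : ℕ) : 0 ≤ ((n + 1 : ℕ) : ℝ) ^ (-s) * hsNorm s (ell1ToL2 a) := by positivity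
  rw [add_mul, one_mul, mul_assoc, ← tsum_mul_right, ENNReal.ofReal_add hH
    (mul_nonneg zero_le_two (tsum_nonneg hpos)), ENNReal.ofReal_mul zero_le_two,
    ENNReal.ofReal_ofNat, ENNReal.ofReal_tsum_of_nonneg hpos hζ']
  refine add_le_add ?_ (mul_le_mul_right (ENNReal.tsum_le_tsum fun n => ?_) 2)
  · rw [← ofReal_norm]
    exact ENNReal.ofReal_le_ofReal (norm_ell1ToEll2_le hs0 ha)
  · rw [← ofReal_norm]
    exact ENNReal.ofReal_le_ofReal (norm_hankelOp_basis_le hs0 ha n)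

end MemHsPlus

theorem mainTheorem5 (s : ℝ) (hs : 1 < s) :
    ∃ C : ℝ, 0 < C ∧
      ∀ (α : ℝ) (u₀ : L2Circle), MemHsPlus s u₀ →
        (∃! u : ℝ → L2Circle, IsAlphaSzegoSolution α u₀ u) ∧
        ∀ u : ℝ → L2Circle, IsAlphaSzegoSolution α u₀ u →
          ∀ t : ℝ, MemWiener (u t) ∧ wienerNorm (u t) ≤ C * hsNorm s u₀ := by
  have hζ : 0 ≤ ∑' n : ℕ, ((n + 1 : ℕ) : ℝ) ^ (-s) := tsum_nonneg fun n => by positivity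
  -- The constant is `1 + 2 ζ(s)`: the `1` bounds the zeroth coefficient through the L² norm, and
  -- each of the two diagonals costs one `ζ(s)`.
  refine ⟨1 + 2 * ∑' n : ℕ, ((n + 1 : ℕ) : ℝ) ^ (-s), by linarith, fun α u₀ h₀ => ?_⟩
  obtain ⟨a, rfl⟩ := h₀.exists_ell1 hs
  obtain ⟨U, rfl, hU, hM, hL2, hmom⟩ := exists_szego_solution α a
    (mul_nonneg (by linarith) (hsNorm_nonneg s _)) (h₀.hankel_bound hs)
  have hsol := isAlphaSzegoSolution_ell1ToL2 hU hL2 hmom (h₀.momentum_ne_top hs.le)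
  refine ⟨⟨_, hsol, fun v hv => hv.unique hsol⟩, fun u hu t => ?_⟩
  obtain rfl := hu.unique hsol
  have e : (fun k : ℕ => ‖fourierCoeff (ell1ToL2 (U t) : S1 → ℂ) (k : ℤ)‖) = fun k => ‖U t k‖ :=
    funext fun k => congrArg norm (natCoeff_ell1ToL2 (U t) k)
  rw [MemWiener, wienerNorm, e, ← Ell1.norm_eq_tsum]
  exact ⟨(U t).summable_norm, hM t⟩
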